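/- Let $n\ge 1$ and let $\mathcal E_n$ be the $\mathbb R$-algebra of germs at $0$ of real $C^\infty$ functions on $\mathbb R^n$. For $f\in\mathcal E_n$ let $J(f)\subset\mathcal E_n$ be the ideal generated by $\partial f/\partial x_1,\dots,\partial f/\partial x_n$, let $\mu(f)=\dim_{\mathbb R}\mathcal E_n/J(f)\in\mathbb N\cup\{\infty\}$ be the real Milnor number of $f$, and say that $f$ has an algebraically isolated singularity at the origin if $\mu(f)<\infty$. For $f\in\mathcal E_n$ with $f(0)=0$, the order $\operatorname{ord}(f)$ is the real number $\alpha\ge 0$ such that $\lim_{t\to0^+} f(tv)/t^\alpha$ exists for every $v\in\mathbb R^n\setminus\{0\}$ and is nonzero for at least one such $v$ (and $\operatorname{ord}(f)=\infty$ if there is no such $\alpha$). The initial part $\operatorname{in}(f)$ of $f$, if it exists, is the positively homogeneous function $f_\alpha$ of some degree $\alpha\ge0$ such that $f_\alpha(x)/\|x\|^\alpha\not\to0$ and $(f(x)-f_\alpha(x))/\|x\|^\alpha\to0$ as $x\to0$. Let $f\colon(\mathbb R^n,0)\to(\mathbb R,0)$ be a germ of a $C^\infty$ function that has an initial part $\operatorname{in}(f)$.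 If $\operatorname{in}(f)$ has an algebraically isolated singularity at the origin, then $\operatorname{ord}(f)$ is a positive integer and $$\mu(f)=(\operatorname{ord}(f)-1)^n .$$ -/

import Mathlib

open Filter Topology
open scoped ContDiff NNReal ENNReal

noncomputable section

namespace RealMilnor

/-- The Euclidean space `ℝⁿ`. -/
abbrev Eucl (n : ℕ) : Type := EuclideanSpace ℝ (Fin n)

/-- The `ℝ`-algebra of all function germs `(ℝⁿ, 0) → ℝ`; the scalars act by multiplication. -/
instance germAlgebra (n : ℕ) : Algebra ℝ (Germ (𝓝 (0 : Eucl n)) ℝ) :=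
  Algebra.ofModule
    (fun r x y => by
      induction x using Germ.inductionOn with | _ f =>
      induction y using Germ.inductionOn with | _ g =>
      exact congrArg _ (smul_mul_assoc r f g))
    (fun r x y => by
      induction x using Germ.inductionOn with | _ f =>
      induction y using Germ.inductionOn with | _ g =>
      exact congrArg _ (mul_smul_comm r f g))

/-- `F` is of class `C^∞` on some neighbourhood of the origin (one neighbourhood for all orders of
differentiation). -/
def SmoothNearZero {n : ℕ} (F : Eucl n → ℝ) : Prop :=
  ∃ U : Set (Eucl n), IsOpen U ∧ (0 : Eucl n) ∈ U ∧ ContDiffOn ℝ ∞ F U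

/-- `𝓔ₙ`: the `ℝ`-algebra of germs at the origin of real `C^∞` functions on `ℝⁿ`. -/
def SmoothGerm (n : ℕ) : Subalgebra ℝ (Germ (𝓝 (0 : Eucl n)) ℝ) where
  carrier := {φ | ∃ F : Eucl n → ℝ, SmoothNearZero F ∧ (F : Germ (𝓝 (0 : Eucl n)) ℝ) = φ}
  mul_mem' := by
    rintro _ _ ⟨F, ⟨U, hU, h0, hF⟩, rfl⟩ ⟨G, ⟨V, hV, h0', hG⟩, rfl⟩
    exact ⟨F * G, ⟨U ∩ V, hU.inter hV, ⟨h0, h0'⟩,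
      (hF.mono Set.inter_subset_left).mul (hG.mono Set.inter_subset_right)⟩, rfl⟩
  add_mem' := by
    rintro _ _ ⟨F, ⟨U, hU, h0, hF⟩, rfl⟩ ⟨G, ⟨V, hV, h0', hG⟩, rfl⟩
    exact ⟨F + G, ⟨U ∩ V, hU.inter hV, ⟨h0, h0'⟩,
      (hF.mono Set.inter_subset_left).add (hG.mono Set.inter_subset_right)⟩, rfl⟩
  algebraMap_mem' := by
    intro r
    refine ⟨r • (1 : Eucl n → ℝ), ⟨Set.univ, isOpen_univ, trivial, ?_⟩, ?_⟩
    · exact contDiffOn_const (𝕜 := ℝ) (c := r • (1 : ℝ))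
    · rw [Algebra.algebraMap_eq_smul_one]
      rfl

/-- The `i`-th partial derivative of a function on `ℝⁿ`. -/
def partialFun {n : ℕ} (i : Fin n) (F : Eucl n → ℝ) : Eucl n → ℝ :=
  fun x => fderiv ℝ F x (EuclideanSpace.single i 1)

/-- The `i`-th partial derivative of a germ. -/
def partialGerm {n : ℕ} (i : Fin n) (φ : Germ (𝓝 (0 : Eucl n)) ℝ) : Germ (𝓝 (0 : Eucl n)) ℝ :=
  Germ.map' (partialFun i)
    (fun F G h => by
      filter_upwards [h.fderiv (𝕜 := ℝ)] with x hx
      simp only [partialFun, hx]) φ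

theorem partialGerm_mem {n : ℕ} (i : Fin n) {φ : Germ (𝓝 (0 : Eucl n)) ℝ}
    (hφ : φ ∈ SmoothGerm n) : partialGerm i φ ∈ SmoothGerm n := by
  obtain ⟨F, ⟨U, hU, h0, hF⟩, rfl⟩ := hφ
  exact ⟨partialFun i F, ⟨U, hU, h0,
    (hF.fderiv_of_isOpen hU (by simp)).clm_apply contDiffOn_const⟩, rfl⟩

/-- `∂f/∂xᵢ ∈ 𝓔ₙ` for `f ∈ 𝓔ₙ`. -/
def partialDeriv {n : ℕ} (i : Fin n) (f : SmoothGerm n) : SmoothGerm n :=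
  ⟨partialGerm i f.1, partialGerm_mem i f.2⟩

/-- The Jacobian ideal `J(f)` of `𝓔ₙ`, generated by the partial derivatives of `f`. -/
def jacobianIdeal {n : ℕ} (f : SmoothGerm n) : Ideal (SmoothGerm n) :=
  Ideal.span (Set.range fun i : Fin n => partialDeriv i f)

/-- The real Milnor number `μ(f) = dim_ℝ 𝓔ₙ / J(f)`, which is `⊤` if the dimension is infinite. -/
def milnorNumber {n : ℕ} (f : SmoothGerm n) : ℕ∞ :=
  Cardinal.toENat (Module.rank ℝ (SmoothGerm n ⧸ jacobianIdeal f))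

/-- `f` has an algebraically isolated singularity at the origin: `μ(f) < ∞`. -/
def AlgebraicallyIsolated {n : ℕ} (f : SmoothGerm n) : Prop :=
  milnorNumber f < ⊤

/-- `F` has finite order `α` at the origin: `F(tv) / t^α` has a limit as `t → 0⁺` for every
`v ≠ 0`, and the limit is nonzero for at least one `v ≠ 0`. -/
def HasOrder {n : ℕ} (F : Eucl n → ℝ) (α : ℝ≥0) : Prop :=
  (∀ v : Eucl n, v ≠ 0 → ∃ L : ℝ, Tendsto (fun t : ℝ => F (t • v) / t ^ (α : ℝ)) (𝓝[>] 0) (𝓝 L)) ∧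
  ∃ v : Eucl n, v ≠ 0 ∧
    ∃ L : ℝ, L ≠ 0 ∧ Tendsto (fun t : ℝ => F (t • v) / t ^ (α : ℝ)) (𝓝[>] 0) (𝓝 L)

open Classical in
/-- The order at the origin of a smooth germ: `0` if `f(0) ≠ 0`, otherwise the number `α` such that
a representative of `f` has order `α` (there is at most one such `α`, and it does not depend on the
representative), and `∞` if there is no such `α`, which for smooth germs means that `f` is flat. -/
def ord {n : ℕ} (f : SmoothGerm n) : ℝ≥0∞ :=
  if f.1.value ≠ 0 then 0
  else ⨅ (α : ℝ≥0) (_ : ∃ F : Eucl n → ℝ, (F : Germ (𝓝 (0 : Eucl n)) ℝ) = f.1 ∧ HasOrder F α),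
    (α : ℝ≥0∞)

/-- `g` is the initial part `in(f)` at the origin of a germ `f` with `f(0) = 0`: for some `α ≥ 0`,
`g` is (the germ of) a function `G` that is positively homogeneous of degree `α`, `G(x) / ‖x‖^α` does
not tend to `0`, and `f = G + o(‖x‖^α)`. -/
def IsInitialPart {n : ℕ} (f g : SmoothGerm n) : Prop :=
  ∃ (α : ℝ≥0) (F G : Eucl n → ℝ),
    (F : Germ (𝓝 (0 : Eucl n)) ℝ) = f.1 ∧ (G : Germ (𝓝 (0 : Eucl n)) ℝ) = g.1 ∧
    (∀ (t : ℝ) (x : Eucl n), 0 < t → G (t • x) = t ^ (α : ℝ) * G x) ∧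
    ¬ Tendsto (fun x => G x / ‖x‖ ^ (α : ℝ)) (𝓝[≠] 0) (𝓝 0) ∧
    Tendsto (fun x => (F x - G x) / ‖x‖ ^ (α : ℝ)) (𝓝[≠] 0) (𝓝 0)

end RealMilnor

end

/-!
A smooth germ that agrees to leading order with a positively homogeneous function has a Taylor
expansion starting with that function, so `in(f)` is a form `P` of degree `m = ord(f) ≥ 1`, and the
`n` partial derivatives of `f` have the leading forms `∂P/∂xᵢ`, of degree `d = m - 1`.

The graded ring of `𝓔ₙ` for the powers of the maximal ideal `𝔪` is `S = ℝ[x₁, …, xₙ]`. As the forms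
`∂P/∂xᵢ` generate an ideal of `S` containing all forms of some large degree, Rees' theorem and prime
avoidance give a regular sequence of `n` linear combinations of them. The quotient by that sequence
has Hilbert series `((1 - t ^ d) / (1 - t)) ^ n`, whose value at `t = 1` is `d ^ n`; hence
`μ(f) ≤ d ^ n`. Conversely `J(f) ^ N ⊆ 𝔪 ^ (d * N)` and `dim 𝓔ₙ/J(f) ^ N ≤ μ(f) * dim 𝓔ₙ/𝔪 ^ N`, and
comparing the growth of both sides as `N → ∞` gives `d ^ n ≤ μ(f)`.
-/

noncomputable section

namespace RealMilnor

/-! ### Regular sequences -/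

section RegularSequences

open CategoryTheory Abelian RingTheory.Sequence
open scoped Pointwise

universe u v

variable {R : Type u} [CommRing R]

theorem exists_mem_isSMulRegular [IsNoetherianRing R] {K M : Type*} [Field K] [Infinite K]
    [Algebra K R] [AddCommGroup M] [Module R M] [Module.Finite R M] {V : Submodule K R} {a : R}
    (haV : a ∈ (Ideal.span (V : Set R)).radical) (ha : IsSMulRegular M a) :
    ∃ c ∈ V, IsSMulRegular M c := by
  classical
  by_contra! hV
  have hfin : (associatedPrimes R M).Finite := associatedPrimes.finite R M
  let s : Finset (Subspace K V) :=
    hfin.toFinset.image fun p => (p.restrictScalars K).comap V.subtype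
  have hcover : (⋃ W ∈ s, (W : Set V)) = Set.univ := by
    refine Set.eq_univ_of_forall fun c => ?_
    have hc : (c : R) ∈ ⋃ p ∈ associatedPrimes R M, (p : Set R) := by
      rw [biUnion_associatedPrimes_eq_compl_regular]
      exact hV c c.2
    obtain ⟨p, hp, hcp⟩ := Set.mem_iUnion₂.1 hc
    exact Set.mem_iUnion₂.2 ⟨_, Finset.mem_image_of_mem _ (hfin.mem_toFinset.2 hp), hcp⟩
  have htop : ⊤ ∈ s := of_not_not fun h => Subspace.biUnion_ne_univ_of_top_notMem h hcover
  obtain ⟨p, hp, hpV⟩ := Finset.mem_image.1 htop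
  rw [hfin.mem_toFinset] at hp
  have hVp : (V : Set R) ⊆ p := fun v hv => hpV.ge (x := ⟨v, hv⟩) trivial
  have hap : a ∈ p := hp.isPrime.radical_le_iff.2 (Ideal.span_le.2 hVp) haV
  have hna : a ∈ ⋃ p ∈ associatedPrimes R M, (p : Set R) := Set.mem_biUnion hp hap
  rw [biUnion_associatedPrimes_eq_compl_regular] at hna
  exact hna ha

theorem subsingleton_ext_quotSMulTop [Small.{v} R] {N M : ModuleCat.{v} R} {c : R}
    (hc : IsSMulRegular M c) {i : ℕ} (h : Subsingleton (Ext N M i))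
    (h' : Subsingleton (Ext N M (i + 1))) :
    Subsingleton (Ext N (ModuleCat.of R (QuotSMulTop c M)) i) :=
  AddCommGrpCat.subsingleton_of_isZero <| ShortComplex.Exact.isZero_of_both_zeros
    (Ext.covariant_sequence_exact₃' N hc.smulShortComplex_shortExact i (i + 1) rfl)
    ((AddCommGrpCat.isZero_of_iff_subsingleton.2 h).eq_zero_of_src _)
    ((AddCommGrpCat.isZero_of_iff_subsingleton.2 h').eq_zero_of_tgt _)

theorem smul_top_quotSMulTop_ne_top {M : Type*} [AddCommGroup M] [Module R M] {I : Ideal R}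
    {c : R} (hc : c ∈ I) (h : I • (⊤ : Submodule R M) ≠ ⊤) :
    I • (⊤ : Submodule R (QuotSMulTop c M)) ≠ ⊤ := by
  intro htop
  refine h (eq_top_iff.2 ?_)
  have hcomap := congrArg (Submodule.comap (Submodule.mkQ (c • (⊤ : Submodule R M)))) htop
  have hle : c • (⊤ : Submodule R M) ≤ I • ⊤ := by
    rw [← Submodule.ideal_span_singleton_smul]
    exact Submodule.smul_mono_left ((Ideal.span_singleton_le_iff_mem I).2 hc)
  rw [Submodule.comap_smul_top_of_surjective I _ (Submodule.mkQ_surjective _)] at hcomap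
  simpa [hle] using hcomap.ge

theorem exists_isRegular_iff_subsingleton_ext [IsNoetherianRing R] [Small.{v} R] {I : Ideal R}
    {M : ModuleCat.{v} R} [Module.Finite R M] (hM : I • (⊤ : Submodule R M) ≠ ⊤) (n : ℕ) :
    (∃ rs : List R, rs.length = n ∧ (∀ r ∈ rs, r ∈ I) ∧ IsRegular M rs) ↔
      ∀ i < n, Subsingleton (Ext (ModuleCat.of R (Shrink.{v} (R ⧸ I))) M i) :=
  (ModuleCat.exists_isRegular_tfae I n M hM.lt_top).out 3 1

/-- By Rees' theorem the existence of `M`-regular sequences in `I` amounts to the vanishing of `Ext`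
groups, which passes to the quotient of `M` by any regular element; so the sequence can be rebuilt
with elements of `V`. -/
theorem exists_isRegular_of_le_radical [IsNoetherianRing R] [Small.{v} R] {K : Type*} [Field K]
    [Infinite K] [Algebra K R] {V : Submodule K R} {I : Ideal R} (hVI : (V : Set R) ⊆ I)
    (hIV : I ≤ (Ideal.span (V : Set R)).radical) {M : ModuleCat.{v} R} [Module.Finite R M]
    (hM : I • (⊤ : Submodule R M) ≠ ⊤) {rs : List R} (hrs : ∀ r ∈ rs, r ∈ I)
    (hreg : IsRegular M rs) :
    ∃ qs : List R, qs.length = rs.length ∧ (∀ q ∈ qs, q ∈ V) ∧ IsRegular M qs := by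
  generalize hn : rs.length = n
  induction n generalizing M rs with
  | zero => exact ⟨[], rfl, by simp, List.length_eq_zero_iff.1 hn ▸ hreg⟩
  | succ n ih =>
    obtain ⟨a, as, rfl⟩ := List.exists_cons_of_length_eq_add_one hn
    obtain ⟨c, hcV, hc⟩ :=
      exists_mem_isSMulRegular (hIV (hrs a (by simp))) ((isRegular_cons_iff M a as).1 hreg).1
    have hM' := smul_top_quotSMulTop_ne_top (hVI hcV) hM
    have hext := (exists_isRegular_iff_subsingleton_ext hM (n + 1)).1 ⟨a :: as, hn, hrs, hreg⟩
    obtain ⟨rs', hn', hrs', hreg'⟩ := (exists_isRegular_iff_subsingleton_ext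
      (M := ModuleCat.of R (QuotSMulTop c M)) hM' n).2 fun i hi =>
        subsingleton_ext_quotSMulTop hc (hext i (by lia)) (hext (i + 1) (by lia))
    obtain ⟨qs, hqs, hqsV, hqsreg⟩ := ih hM' hrs' hreg' hn'
    exact ⟨c :: qs, by simp [hqs], by simpa [hcV] using hqsV, .cons hc hqsreg⟩

end RegularSequences

/-! ### Forms -/

section Forms

open MvPolynomial RingTheory.Sequence

attribute [local instance] MvPolynomial.gradedAlgebra

variable {σ K : Type*} [CommRing K] {A : Ideal (MvPolynomial σ K)} {q : MvPolynomial σ K} {d e : ℕ}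

theorem homogeneousComponent_mul_of_isHomogeneous (hq : q.IsHomogeneous d) (e : ℕ)
    (s : MvPolynomial σ K) :
    homogeneousComponent e (q * s) = if d ≤ e then q * homogeneousComponent (e - d) s else 0 := by
  simp only [← decomposition.decompose'_apply]
  exact DirectSum.coe_decompose_mul_of_left_mem _ e ((mem_homogeneousSubmodule d q).2 hq)

theorem isHomogeneous_span {S : Set (MvPolynomial σ K)} (hS : ∀ q ∈ S, q.IsHomogeneous d) :
    (Ideal.span S).IsHomogeneous (homogeneousSubmodule σ K) :=
  Ideal.homogeneous_span _ _ fun q hq => ⟨d, hS q hq⟩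

theorem mem_span_singleton_sup_iff_of_lt (hA : A.IsHomogeneous (homogeneousSubmodule σ K))
    (hq : q.IsHomogeneous d) {p : MvPolynomial σ K} (hp : p.IsHomogeneous e) (hed : e < d) :
    p ∈ Ideal.span {q} ⊔ A ↔ p ∈ A := by
  refine ⟨fun h => ?_, fun h => Ideal.mem_sup_right h⟩
  obtain ⟨s, a, ha, rfl⟩ := Ideal.mem_span_singleton_sup.1 h
  rw [← homogeneousComponent_eq_self hp, map_add, mul_comm,
    homogeneousComponent_mul_of_isHomogeneous hq, if_neg (by lia), zero_add]
  exact homogeneousComponent_mem_of_mem hA ha e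

theorem mem_span_singleton_sup_iff (hA : A.IsHomogeneous (homogeneousSubmodule σ K))
    (hq : q.IsHomogeneous d) {p : MvPolynomial σ K} (hp : p.IsHomogeneous (d + e)) :
    p ∈ Ideal.span {q} ⊔ A ↔ ∃ s : MvPolynomial σ K, s.IsHomogeneous e ∧ p - q * s ∈ A := by
  refine ⟨fun h => ?_, fun ⟨s, _, hs⟩ => ?_⟩
  · obtain ⟨s, a, ha, rfl⟩ := Ideal.mem_span_singleton_sup.1 h
    refine ⟨_, homogeneousComponent_isHomogeneous e s, ?_⟩
    have hcomp := homogeneousComponent_mul_of_isHomogeneous hq (d + e) s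
    rw [if_pos (Nat.le_add_right d e), Nat.add_sub_cancel_left] at hcomp
    rw [← homogeneousComponent_eq_self hp, map_add, mul_comm s, hcomp, add_sub_cancel_left]
    exact homogeneousComponent_mem_of_mem hA ha _
  · exact Ideal.mem_span_singleton_sup.2 ⟨s, _, hs, by ring⟩

theorem mem_idealOfVars_pow_of_isHomogeneous {p : MvPolynomial σ K} (hp : p.IsHomogeneous e) :
    p ∈ idealOfVars σ K ^ e :=
  (mem_pow_idealOfVars_iff e p).2 fun m hm =>
    (of_not_not fun h => mem_support_iff.1 hm (hp.coeff_eq_zero h) : m.degree = e).ge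

theorem mem_idealOfVars_of_isHomogeneous {p : MvPolynomial σ K} (hp : p.IsHomogeneous e)
    (he : e ≠ 0) : p ∈ idealOfVars σ K :=
  Ideal.pow_le_self he (mem_idealOfVars_pow_of_isHomogeneous hp)

theorem sub_homogeneousComponent_mem_idealOfVars_pow {p : MvPolynomial σ K}
    (hp : p ∈ idealOfVars σ K ^ e) : p - homogeneousComponent e p ∈ idealOfVars σ K ^ (e + 1) := by
  rw [mem_pow_idealOfVars_iff'] at hp ⊢
  intro m hm
  rw [coeff_sub, coeff_homogeneousComponent]
  split_ifs with h
  · rw [sub_self]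
  · rw [hp m (by lia), sub_zero]

theorem homogeneousComponent_eq_zero_of_mem_idealOfVars_pow {p : MvPolynomial σ K} {k : ℕ}
    (hp : p ∈ idealOfVars σ K ^ k) (he : e < k) : homogeneousComponent e p = 0 := by
  ext m
  rw [coeff_homogeneousComponent, coeff_zero]
  split_ifs with h
  · exact (mem_pow_idealOfVars_iff' k p).1 hp m (by lia)
  · rfl

theorem idealOfVars_ne_top [Nontrivial K] : idealOfVars σ K ≠ ⊤ := by
  rw [Ideal.ne_top_iff_one, ← pow_one (idealOfVars σ K), mem_pow_idealOfVars_iff]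
  simp

theorem isSMulRegular_X {S : Set σ} {i : σ} (hi : i ∉ S) :
    IsSMulRegular (MvPolynomial σ K ⧸ Ideal.span (X '' S : Set (MvPolynomial σ K)))
      (X i : MvPolynomial σ K) := by
  rw [isSMulRegular_quotient_iff_mem_of_smul_mem]
  intro p hp
  rw [mem_ideal_span_X_image] at hp ⊢
  intro m hm
  obtain ⟨j, hj, hmj⟩ := hp (m + Finsupp.single i 1) (by
    rw [mem_support_iff, smul_eq_mul, mul_comm, coeff_mul_X]
    exact mem_support_iff.1 hm)
  have hij : i ≠ j := fun h => hi (h ▸ hj)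
  exact ⟨j, hj, by simpa [hij] using hmj⟩

theorem isWeaklyRegular_map_X {l : List σ} (hl : l.Nodup) :
    IsWeaklyRegular (MvPolynomial σ K) (l.map (X : σ → MvPolynomial σ K)) := by
  induction l using List.reverseRecOn with
  | nil => exact .nil _ _
  | append_singleton l i ih =>
    obtain ⟨hl, -, hi⟩ := List.nodup_append.1 hl
    have hspan : Ideal.ofList (l.map X) =
        Ideal.span (X '' {j | j ∈ l} : Set (MvPolynomial σ K)) := by
      simp [Ideal.ofList, Set.image]
    rw [List.map_append, isWeaklyRegular_append_iff, List.map_singleton,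
      isWeaklyRegular_singleton_iff, smul_eq_mul, Ideal.mul_top, hspan]
    exact ⟨ih hl, isSMulRegular_X fun h => hi i h i (by simp) rfl⟩

end Forms

/-! ### Hilbert functions -/

section HilbertFunction

open MvPolynomial RingTheory.Sequence

attribute [local instance] MvPolynomial.gradedAlgebra

variable {σ K : Type*} [Field K] {A B : Ideal (MvPolynomial σ K)} {q : MvPolynomial σ K} {d e : ℕ}

theorem span_range_eq_top_of_isHomogeneous_zero [Nonempty σ] {P : σ → MvPolynomial σ K}
    (hP : ∀ i, (P i).IsHomogeneous 0) {k : ℕ}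
    (hk : ∀ p : MvPolynomial σ K, p.IsHomogeneous k → p ∈ Ideal.span (Set.range P)) :
    Ideal.span (Set.range P) = ⊤ := by
  obtain ⟨i, hi⟩ : ∃ i, P i ≠ 0 := by
    by_contra! hzero
    have hbot : Ideal.span (Set.range P) = ⊥ :=
      Ideal.span_eq_bot.2 (Set.forall_mem_range.2 hzero)
    have hX := hk _ (isHomogeneous_X_pow (Classical.arbitrary σ) k)
    rw [hbot, Ideal.mem_bot] at hX
    exact pow_ne_zero k (X_ne_zero _) hX
  have hC : P i = C (coeff 0 (P i)) :=
    totalDegree_eq_zero_iff_eq_C.1 ((totalDegree_zero_iff_isHomogeneous _).2 (hP i))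
  refine Ideal.eq_top_of_isUnit_mem _ (Ideal.subset_span ⟨i, rfl⟩) ?_
  rw [hC] at hi ⊢
  exact (isUnit_iff_ne_zero.2 fun h => hi (by rw [h, C_0])).map C

/-- The part of degree `e` of an ideal of a polynomial ring, as a subspace of the space of forms of
degree `e`. -/
def gradedPart (A : Ideal (MvPolynomial σ K)) (e : ℕ) : Submodule K (homogeneousSubmodule σ K e) :=
  (A.restrictScalars K).submoduleOf (homogeneousSubmodule σ K e)

/-- The Hilbert function of the quotient of a polynomial ring by an ideal. -/
def hilbertFun (A : Ideal (MvPolynomial σ K)) (e : ℕ) : ℕ :=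
  Module.finrank K (homogeneousSubmodule σ K e ⧸ gradedPart A e)

theorem mem_gradedPart {p : homogeneousSubmodule σ K e} :
    p ∈ gradedPart A e ↔ (p : MvPolynomial σ K) ∈ A := Iff.rfl

theorem hilbertFun_eq_zero (h : ∀ p : MvPolynomial σ K, p.IsHomogeneous e → p ∈ A) :
    hilbertFun A e = 0 := by
  have htop : gradedPart A e = ⊤ := eq_top_iff.2 fun p _ => h p p.2
  have := Submodule.Quotient.subsingleton_iff.2 htop
  exact Module.finrank_zero_of_subsingleton

theorem hilbertFun_bot (e : ℕ) :
    hilbertFun (⊥ : Ideal (MvPolynomial σ K)) e =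
      Module.finrank K (homogeneousSubmodule σ K e) := by
  have hbot : gradedPart (⊥ : Ideal (MvPolynomial σ K)) e = ⊥ :=
    eq_bot_iff.2 fun p hp => Subtype.ext hp
  rw [hilbertFun, hbot, (Submodule.quotEquivOfEqBot ⊥ rfl).finrank_eq]

theorem hilbertFun_span_singleton_sup_of_lt (hA : A.IsHomogeneous (homogeneousSubmodule σ K))
    (hq : q.IsHomogeneous d) (hed : e < d) :
    hilbertFun (Ideal.span {q} ⊔ A) e = hilbertFun A e := by
  have : gradedPart (Ideal.span {q} ⊔ A) e = gradedPart A e :=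
    Submodule.ext fun p => mem_span_singleton_sup_iff_of_lt hA hq p.2 hed
  rw [hilbertFun, hilbertFun, this]

theorem hilbertFun_idealOfVars_zero : hilbertFun (idealOfVars σ K) 0 = 1 := by
  have hbot : gradedPart (idealOfVars σ K) 0 = ⊥ := by
    refine eq_bot_iff.2 fun p hp => Subtype.ext ?_
    rw [mem_gradedPart, ← pow_one (idealOfVars σ K), mem_pow_idealOfVars_iff] at hp
    refine support_eq_empty.1 (Finset.eq_empty_iff_forall_notMem.2 fun m hm => ?_)
    have hdeg : m.degree = 0 := of_not_not fun h => mem_support_iff.1 hm (p.2.coeff_eq_zero h)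
    exact absurd (hp m hm) (by lia)
  rw [hilbertFun, hbot, (Submodule.quotEquivOfEqBot ⊥ rfl).finrank_eq, homogeneousSubmodule_zero,
    Submodule.one_eq_span, finrank_span_singleton one_ne_zero]

/-- The Hilbert series of the quotient of a polynomial ring by an ideal, with coefficients in `ℤ` so
that it can be multiplied by `1 - t ^ d`. -/
def hilbertSeries (A : Ideal (MvPolynomial σ K)) : PowerSeries ℤ :=
  PowerSeries.mk fun e => (hilbertFun A e : ℤ)

theorem hilbertSeries_idealOfVars : hilbertSeries (idealOfVars σ K) = 1 := by
  ext e
  rw [hilbertSeries, PowerSeries.coeff_mk, PowerSeries.coeff_one]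
  split_ifs with he
  · rw [he, hilbertFun_idealOfVars_zero, Nat.cast_one]
  · rw [hilbertFun_eq_zero fun p hp => mem_idealOfVars_of_isHomogeneous hp he, Nat.cast_zero]

variable [Finite σ]

instance finite_homogeneousSubmodule (e : ℕ) : Module.Finite K (homogeneousSubmodule σ K e) :=
  Module.Finite.iff_fg.2 (homogeneousSubmodule_fg σ K e)

theorem hilbertFun_anti (h : A ≤ B) (e : ℕ) : hilbertFun B e ≤ hilbertFun A e :=
  LinearMap.finrank_le_finrank_of_surjective
    (Submodule.factor_surjective fun p (hp : p ∈ gradedPart A e) => h hp)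

/-- Multiplication by `q` identifies `(S ⧸ A)ₑ` with the kernel of
`(S ⧸ A)_{d+e} → (S ⧸ (A, q))_{d+e}`. -/
theorem hilbertFun_span_singleton_sup_add (hA : A.IsHomogeneous (homogeneousSubmodule σ K))
    (hq : q.IsHomogeneous d) (hreg : IsSMulRegular (MvPolynomial σ K ⧸ A) q) (e : ℕ) :
    hilbertFun (Ideal.span {q} ⊔ A) (d + e) + hilbertFun A e = hilbertFun A (d + e) := by
  let mulq : homogeneousSubmodule σ K e →ₗ[K] homogeneousSubmodule σ K (d + e) :=
    (LinearMap.mulLeft K q).restrict fun s hs => hq.mul hs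
  have hcomap : (gradedPart A (d + e)).comap mulq = gradedPart A e := by
    ext s
    exact ⟨mem_of_isSMulRegular_quotient_of_smul_mem hreg, A.mul_mem_left q⟩
  let ψ := (gradedPart A e).mapQ (gradedPart A (d + e)) mulq hcomap.ge
  have hψ : Function.Injective ψ := by
    rw [← LinearMap.ker_eq_bot, Submodule.ker_mapQ, hcomap, Submodule.mkQ_map_self]
  have hle : gradedPart A (d + e) ≤ gradedPart (Ideal.span {q} ⊔ A) (d + e) :=
    fun p hp => Ideal.mem_sup_right hp
  have hrange : ψ.range = (gradedPart (Ideal.span {q} ⊔ A) (d + e)).map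
      (gradedPart A (d + e)).mkQ := by
    rw [Submodule.range_mapQ]
    refine le_antisymm (Submodule.map_le_iff_le_comap.2 ?_) (Submodule.map_le_iff_le_comap.2 ?_)
    · rintro _ ⟨s, rfl⟩
      exact Submodule.mem_map_of_mem
        (Ideal.mem_sup_left (Ideal.mul_mem_right _ _ (Ideal.mem_span_singleton_self q)))
    · intro p hp
      obtain ⟨s, hs, hps⟩ := (mem_span_singleton_sup_iff hA hq p.2).1 hp
      exact ⟨_, ⟨⟨s, hs⟩, rfl⟩, ((Submodule.Quotient.eq (gradedPart A (d + e))).2 hps).symm⟩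
  have := (Submodule.quotientQuotientEquivQuotient _ _ hle).finrank_eq
  rw [hilbertFun, ← this, hilbertFun, ← LinearMap.finrank_range_of_inj hψ, hrange, hilbertFun]
  exact Submodule.finrank_quotient_add_finrank _

theorem hilbertSeries_span_singleton_sup (hA : A.IsHomogeneous (homogeneousSubmodule σ K))
    (hq : q.IsHomogeneous d) (hreg : IsSMulRegular (MvPolynomial σ K ⧸ A) q) :
    hilbertSeries (Ideal.span {q} ⊔ A) = (1 - PowerSeries.X ^ d) * hilbertSeries A := by
  ext e
  rw [sub_mul, one_mul, map_sub, PowerSeries.coeff_X_pow_mul']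
  simp only [hilbertSeries, PowerSeries.coeff_mk]
  split_ifs with hde
  · obtain ⟨e, rfl⟩ := Nat.exists_eq_add_of_le hde
    rw [Nat.add_sub_cancel_left, ← hilbertFun_span_singleton_sup_add hA hq hreg]
    simp
  · rw [hilbertFun_span_singleton_sup_of_lt hA hq (by lia), sub_zero]

theorem hilbertSeries_ofList {rs : List (MvPolynomial σ K)} (hrs : ∀ q ∈ rs, q.IsHomogeneous d)
    (hreg : IsWeaklyRegular (MvPolynomial σ K) rs) :
    hilbertSeries (Ideal.ofList rs) =
      (1 - PowerSeries.X ^ d) ^ rs.length * hilbertSeries (⊥ : Ideal (MvPolynomial σ K)) := by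
  induction rs using List.reverseRecOn with
  | nil => simp
  | append_singleton rs q ih =>
    rw [isWeaklyRegular_append_iff, isWeaklyRegular_singleton_iff, smul_eq_mul,
      Ideal.mul_top] at hreg
    have hrs' : ∀ r ∈ rs, r.IsHomogeneous d := fun r hr => hrs r (by simp [hr])
    have hA : (Ideal.ofList rs).IsHomogeneous (homogeneousSubmodule σ K) := isHomogeneous_span hrs'
    rw [Ideal.ofList_append, Ideal.ofList_singleton, sup_comm,
      hilbertSeries_span_singleton_sup hA (hrs q (by simp)) hreg.2,
      ih hrs' hreg.1, List.length_append, List.length_singleton, pow_succ', mul_assoc]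

end HilbertFunction

section CompleteIntersection

open MvPolynomial RingTheory.Sequence

variable {σ K : Type*} [Fintype σ] [Field K] {d : ℕ}

theorem ofList_map_X_toList :
    Ideal.ofList ((Finset.univ.toList : List σ).map (X : σ → MvPolynomial σ K)) =
      idealOfVars σ K := by
  simp [Ideal.ofList, idealOfVars, Set.range]

theorem one_sub_X_pow_mul_hilbertSeries_bot :
    (1 - PowerSeries.X) ^ Fintype.card σ * hilbertSeries (⊥ : Ideal (MvPolynomial σ K)) = 1 := by
  have h := hilbertSeries_ofList (K := K) (d := 1) (by simp [isHomogeneous_X])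
    (isWeaklyRegular_map_X (Finset.univ : Finset σ).nodup_toList)
  rw [ofList_map_X_toList, hilbertSeries_idealOfVars] at h
  simpa using h.symm

theorem sum_finrank_homogeneousSubmodule (N : ℕ) :
    ∑ e ∈ Finset.range (N + 1), Module.finrank K (homogeneousSubmodule σ K e) =
      (Fintype.card σ + N).choose (Fintype.card σ) := by
  have hne : (1 - PowerSeries.X : PowerSeries ℤ) ^ (Fintype.card σ + 1) ≠ 0 := by
    refine pow_ne_zero _ fun h => ?_
    simpa using congrArg (PowerSeries.coeff 0) h
  have hseries : hilbertSeries (⊥ : Ideal (MvPolynomial σ K)) * PowerSeries.mk 1 =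
      PowerSeries.mk fun N => ((Fintype.card σ + N).choose (Fintype.card σ) : ℤ) := by
    refine mul_left_cancel₀ hne (Eq.trans (b := 1) ?_ ?_)
    · rw [pow_succ, mul_mul_mul_comm, one_sub_X_pow_mul_hilbertSeries_bot, one_mul, mul_comm,
        PowerSeries.mk_one_mul_one_sub_eq_one]
    · rw [mul_comm, PowerSeries.mk_add_choose_mul_one_sub_pow_eq_one]
  have hcoeff := congrArg (PowerSeries.coeff N) hseries
  rw [PowerSeries.coeff_mul, Finset.Nat.sum_antidiagonal_eq_sum_range_succ_mk] at hcoeff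
  simp only [hilbertSeries, PowerSeries.coeff_mk, Pi.one_apply, mul_one, hilbertFun_bot] at hcoeff
  exact_mod_cast hcoeff

theorem pow_card_le_factorial_mul_sum_finrank {N : ℕ} (hN : N ≠ 0) :
    N ^ Fintype.card σ ≤ (Fintype.card σ).factorial *
      ∑ e ∈ Finset.range N, Module.finrank K (homogeneousSubmodule σ K e) := by
  obtain ⟨N, rfl⟩ := Nat.exists_eq_succ_of_ne_zero hN
  rw [Nat.succ_eq_add_one, sum_finrank_homogeneousSubmodule, add_comm (Fintype.card σ),
    ← Nat.ascFactorial_eq_factorial_mul_choose]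
  exact Nat.pow_succ_le_ascFactorial _ _

theorem factorial_mul_sum_finrank_le_pow_card {N : ℕ} (hN : N ≠ 0) :
    (Fintype.card σ).factorial *
      ∑ e ∈ Finset.range N, Module.finrank K (homogeneousSubmodule σ K e) ≤
        (N + Fintype.card σ) ^ Fintype.card σ := by
  obtain ⟨N, rfl⟩ := Nat.exists_eq_succ_of_ne_zero hN
  rw [Nat.succ_eq_add_one, sum_finrank_homogeneousSubmodule, add_comm (Fintype.card σ),
    ← Nat.ascFactorial_eq_factorial_mul_choose]
  exact (Nat.ascFactorial_le_pow_add _ _).trans (Nat.pow_le_pow_left (by lia) _)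

theorem hilbertSeries_ofList_eq_geom_sum_pow {qs : List (MvPolynomial σ K)}
    (hqs : ∀ q ∈ qs, q.IsHomogeneous d) (hlen : qs.length = Fintype.card σ)
    (hreg : IsWeaklyRegular (MvPolynomial σ K) qs) :
    hilbertSeries (Ideal.ofList qs) =
      (((∑ i ∈ Finset.range d, Polynomial.X ^ i) ^ Fintype.card σ : Polynomial ℤ) :
        PowerSeries ℤ) := by
  have hgeom : ((∑ i ∈ Finset.range d, Polynomial.X ^ i : Polynomial ℤ) : PowerSeries ℤ) *
      (1 - PowerSeries.X) = 1 - PowerSeries.X ^ d := by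
    have := congrArg (fun p : Polynomial ℤ => (p : PowerSeries ℤ))
      (geom_sum_mul_neg (Polynomial.X : Polynomial ℤ) d)
    simpa using this
  rw [hilbertSeries_ofList hqs hreg, hlen, ← hgeom, mul_pow, mul_assoc,
    one_sub_X_pow_mul_hilbertSeries_bot, mul_one, Polynomial.coe_pow]

theorem sum_hilbertFun_ofList_le {qs : List (MvPolynomial σ K)}
    (hqs : ∀ q ∈ qs, q.IsHomogeneous d) (hlen : qs.length = Fintype.card σ)
    (hreg : IsWeaklyRegular (MvPolynomial σ K) qs) (N : ℕ) :
    ∑ e ∈ Finset.range N, hilbertFun (Ideal.ofList qs) e ≤ d ^ Fintype.card σ := by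
  have h := hilbertSeries_ofList_eq_geom_sum_pow hqs hlen hreg
  set p : Polynomial ℤ := (∑ i ∈ Finset.range d, Polynomial.X ^ i) ^ Fintype.card σ with hp
  have hcoeff (e : ℕ) : (hilbertFun (Ideal.ofList qs) e : ℤ) = p.coeff e := by
    simpa [hilbertSeries] using congrArg (PowerSeries.coeff e) h
  have heval : p.eval 1 = (d : ℤ) ^ Fintype.card σ := by simp [hp, Polynomial.eval_finsetSum]
  zify
  rw [← heval, Polynomial.eval_eq_sum_range' (n := max N (p.natDegree + 1)) (by lia)]
  simp_rw [one_pow, mul_one, ← hcoeff]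
  exact Finset.sum_le_sum_of_subset_of_nonneg (Finset.range_mono (le_max_left _ _))
    fun e _ _ => Nat.cast_nonneg _

theorem isRegular_map_X_toList :
    IsRegular (MvPolynomial σ K)
      ((Finset.univ.toList : List σ).map (X : σ → MvPolynomial σ K)) := by
  refine ⟨isWeaklyRegular_map_X (Finset.nodup_toList _), ?_⟩
  rw [ofList_map_X_toList, smul_eq_mul, Ideal.mul_top]
  exact idealOfVars_ne_top.symm

theorem exists_isRegular_mem_span [Infinite K] (hd : d ≠ 0) {P : σ → MvPolynomial σ K}
    (hP : ∀ i, (P i).IsHomogeneous d) {k : ℕ}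
    (hk : ∀ p : MvPolynomial σ K, p.IsHomogeneous k → p ∈ Ideal.span (Set.range P)) :
    ∃ qs : List (MvPolynomial σ K), qs.length = Fintype.card σ ∧
      (∀ q ∈ qs, q ∈ Submodule.span K (Set.range P)) ∧ IsRegular (MvPolynomial σ K) qs := by
  set V : Submodule K (MvPolynomial σ K) := Submodule.span K (Set.range P)
  have hVI : (V : Set (MvPolynomial σ K)) ⊆ idealOfVars σ K :=
    (Submodule.span_le (p := (idealOfVars σ K).restrictScalars K)).2
      (Set.range_subset_iff.2 fun i => mem_idealOfVars_of_isHomogeneous (hP i) hd)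
  have hrad : idealOfVars σ K ≤ (Ideal.span (V : Set (MvPolynomial σ K))).radical :=
    Ideal.span_le.2 <| Set.range_subset_iff.2 fun i =>
      ⟨k, Ideal.span_mono Submodule.subset_span (hk _ (isHomogeneous_X_pow i k))⟩
  obtain ⟨qs, hlen, hqs, hreg⟩ := exists_isRegular_of_le_radical hVI hrad
    (M := ModuleCat.of (MvPolynomial σ K) (MvPolynomial σ K))
    (by simpa using idealOfVars_ne_top) (rs := (Finset.univ.toList : List σ).map X)
    (by simpa using fun i => Ideal.subset_span (Set.mem_range_self i)) isRegular_map_X_toList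
  exact ⟨qs, by simpa using hlen, hqs, hreg⟩

theorem sum_hilbertFun_span_le_of_ne_zero [Infinite K] (hd : d ≠ 0)
    {P : σ → MvPolynomial σ K} (hP : ∀ i, (P i).IsHomogeneous d) {k : ℕ}
    (hk : ∀ p : MvPolynomial σ K, p.IsHomogeneous k → p ∈ Ideal.span (Set.range P)) (N : ℕ) :
    ∑ e ∈ Finset.range N, hilbertFun (Ideal.span (Set.range P)) e ≤ d ^ Fintype.card σ := by
  obtain ⟨qs, hlen, hqs, hreg⟩ := exists_isRegular_mem_span hd hP hk
  have hhom : ∀ q ∈ qs, q.IsHomogeneous d := fun q hq =>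
    (Submodule.span_le (p := homogeneousSubmodule σ K d)).2 (Set.range_subset_iff.2 hP) (hqs q hq)
  have hle : Ideal.ofList qs ≤ Ideal.span (Set.range P) := Ideal.span_le.2 fun q hq =>
    (Submodule.span_le (p := (Ideal.span (Set.range P)).restrictScalars K)).2
      Ideal.subset_span (hqs q hq)
  exact (Finset.sum_le_sum fun e _ => hilbertFun_anti hle e).trans
    (sum_hilbertFun_ofList_le hhom hlen hreg.toIsWeaklyRegular N)

theorem sum_hilbertFun_span_le [Infinite K] {P : σ → MvPolynomial σ K}
    (hP : ∀ i, (P i).IsHomogeneous d) {k : ℕ}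
    (hk : ∀ p : MvPolynomial σ K, p.IsHomogeneous k → p ∈ Ideal.span (Set.range P)) (N : ℕ) :
    ∑ e ∈ Finset.range N, hilbertFun (Ideal.span (Set.range P)) e ≤ d ^ Fintype.card σ := by
  rcases eq_or_ne d 0 with rfl | hd
  · cases isEmpty_or_nonempty σ with
    | inl _ => simpa using sum_hilbertFun_span_le_of_ne_zero one_ne_zero isEmptyElim hk N
    | inr _ =>
      have htop := span_range_eq_top_of_isHomogeneous_zero hP hk
      rw [Finset.sum_eq_zero fun e _ => hilbertFun_eq_zero fun p _ => htop ▸ Submodule.mem_top]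
      exact Nat.zero_le _
  · exact sum_hilbertFun_span_le_of_ne_zero hd hP hk N

end CompleteIntersection

/-! ### Local algebras whose associated graded ring is a polynomial ring -/

section LinearMap

variable {K V₁ V₂ V₃ : Type*} [Field K] [AddCommGroup V₁] [Module K V₁] [AddCommGroup V₂]
  [Module K V₂] [AddCommGroup V₃] [Module K V₃] [Module.Finite K V₁] [Module.Finite K V₃]
  {f : V₁ →ₗ[K] V₂} {g : V₂ →ₗ[K] V₃}

theorem finite_of_ker_le_range (h : g.ker ≤ f.range) : Module.Finite K V₂ := by
  have : Module.Finite K g.ker := Submodule.finiteDimensional_of_le h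
  have : Module.Finite K (V₂ ⧸ g.ker) := Module.Finite.equiv g.quotKerEquivRange.symm
  exact Module.Finite.of_submodule_quotient g.ker

theorem finrank_le_of_ker_le_range (h : g.ker ≤ f.range) :
    Module.finrank K V₂ ≤ Module.finrank K V₁ + Module.finrank K V₃ := by
  have := finite_of_ker_le_range h
  rw [← g.finrank_range_add_finrank_ker, add_comm]
  exact add_le_add ((Submodule.finrank_mono h).trans f.finrank_range_le)
    (Submodule.finrank_le _)

end LinearMap

section Coordinates

open MvPolynomial

variable {σ K E : Type*} [CommRing K] [CommRing E] [Algebra K E] {x : σ → E}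

local notation "𝔪" => Ideal.span (Set.range x)

theorem map_aeval_idealOfVars (x : σ → E) :
    (idealOfVars σ K).map (aeval x) = Ideal.span (Set.range x) := by
  rw [idealOfVars, Ideal.map_span, ← Set.range_comp]
  congr! 2
  ext i
  simp

theorem aeval_mem_pow {p : MvPolynomial σ K} {k : ℕ} (hp : p ∈ idealOfVars σ K ^ k) :
    aeval x p ∈ 𝔪 ^ k := by
  rw [← map_aeval_idealOfVars (K := K), ← Ideal.map_pow]
  exact Ideal.mem_map_of_mem _ hp

variable (K x) in
/-- The conditions on a family of elements `x` of a `K`-algebra `E` under which `E` behaves like the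
local ring of germs with coordinates `x`: it is the sum of `K` and of the ideal `𝔪` generated by
`x`, this ideal lies in the Jacobson radical, and the associated graded ring of `E` with respect to
`𝔪` is the polynomial ring in the classes of `x`. -/
structure IsCoordinates : Prop where
  exists_sub_algebraMap_mem : ∀ φ : E, ∃ c : K, φ - algebraMap K E c ∈ 𝔪
  eq_zero_of_aeval_mem : ∀ (k : ℕ) (p : MvPolynomial σ K), p.IsHomogeneous k →
    aeval x p ∈ 𝔪 ^ (k + 1) → p = 0
  le_jacobson : 𝔪 ≤ Ideal.jacobson ⊥

namespace IsCoordinates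

theorem exists_isHomogeneous (hx : IsCoordinates K x) {k : ℕ} {φ : E} (hφ : φ ∈ 𝔪 ^ k) :
    ∃ p : MvPolynomial σ K, p.IsHomogeneous k ∧ φ - aeval x p ∈ 𝔪 ^ (k + 1) := by
  obtain ⟨P, hP, rfl⟩ := (Ideal.mem_span_pow_iff_exists_isHomogeneous _ _).1 hφ
  choose c hc using hx.exists_sub_algebraMap_mem
  have hdeg {m : σ →₀ ℕ} (hm : m ∈ P.support) : m.degree = k :=
    of_not_not fun h => mem_support_iff.1 hm (hP.coeff_eq_zero h)
  refine ⟨∑ m ∈ P.support, monomial m (c (P.coeff m)),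
    IsHomogeneous.sum _ _ _ fun m hm => isHomogeneous_monomial _ (hdeg hm), ?_⟩
  rw [eval_eq, map_sum, ← Finset.sum_sub_distrib]
  refine Ideal.sum_mem _ fun m hm => ?_
  have hm' := aeval_mem_pow (x := x)
    (mem_idealOfVars_pow_of_isHomogeneous (isHomogeneous_monomial (1 : K) (hdeg hm)))
  rw [aeval_monomial, map_one, one_mul] at hm'
  rw [aeval_monomial, Finsupp.prod, ← sub_mul, pow_succ']
  exact Ideal.mul_mem_mul (hc _) hm'

theorem exists_sub_aeval_mem_pow (hx : IsCoordinates K x) (φ : E) (k : ℕ) :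
    ∃ p : MvPolynomial σ K, φ - aeval x p ∈ 𝔪 ^ k := by
  induction k with
  | zero => exact ⟨0, by simp⟩
  | succ k ih =>
    obtain ⟨p, hp⟩ := ih
    obtain ⟨q, -, hpq⟩ := hx.exists_isHomogeneous hp
    exact ⟨p + q, by rwa [map_add, ← sub_sub]⟩

theorem aeval_mem_pow_iff (hx : IsCoordinates K x) {p : MvPolynomial σ K} {k : ℕ} :
    aeval x p ∈ 𝔪 ^ k ↔ p ∈ idealOfVars σ K ^ k := by
  refine ⟨fun h => ?_, aeval_mem_pow⟩
  induction k with
  | zero => simp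
  | succ k ih =>
    have hp := sub_homogeneousComponent_mem_idealOfVars_pow
      (ih (Ideal.pow_le_pow_right k.le_succ h))
    have hzero : homogeneousComponent k p = 0 := by
      refine hx.eq_zero_of_aeval_mem k _ (homogeneousComponent_isHomogeneous k p) ?_
      rw [← sub_sub_cancel p (homogeneousComponent k p), map_sub]
      exact Ideal.sub_mem _ h (aeval_mem_pow hp)
    rwa [hzero, sub_zero] at hp

end IsCoordinates

end Coordinates

/-! ### Upper bound for the codimension -/

section UpperBound

open MvPolynomial

attribute [local instance] MvPolynomial.gradedAlgebra

variable {σ K E : Type*} [Field K] [CommRing E] [Algebra K E] {x : σ → E}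

local notation "𝔪" => Ideal.span (Set.range x)

theorem exists_pow_le_of_le_jacobson {I J : Ideal E} (hI : I ≤ Ideal.jacobson ⊥)
    [Module.Finite K (E ⧸ J)] : ∃ k, I ^ k ≤ J := by
  have : IsArtinianRing (E ⧸ J) := IsArtinianRing.of_finite K _
  obtain ⟨k, hk⟩ := IsArtinianRing.isNilpotent_jacobson_bot (R := E ⧸ J)
  refine ⟨k, ?_⟩
  have hmap : I.map (Ideal.Quotient.mk J) ≤ Ideal.jacobson ⊥ := by
    have h := Ideal.map_jacobson_of_surjective (Ideal.Quotient.mk_surjective (I := J))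
      (Ideal.mk_ker (I := J)).le
    rw [Ideal.map_quotient_self] at h
    exact h ▸ Ideal.map_mono (hI.trans (Ideal.jacobson_mono bot_le))
  rw [← Ideal.mk_ker (I := J), ← Ideal.map_eq_bot_iff_le_ker, Ideal.map_pow, eq_bot_iff]
  exact (Ideal.pow_right_mono hmap k).trans hk.le

theorem IsCoordinates.exists_sub_aeval_mem_pow_of_mem_map (hx : IsCoordinates K x)
    {A : Ideal (MvPolynomial σ K)} {φ : E} (hφ : φ ∈ A.map (aeval x)) (k : ℕ) :
    ∃ a ∈ A, φ - aeval x a ∈ 𝔪 ^ k := by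
  induction hφ using Submodule.span_induction with
  | mem _ h =>
    obtain ⟨a, ha, rfl⟩ := h
    exact ⟨a, ha, by simp⟩
  | zero => exact ⟨0, A.zero_mem, by simp⟩
  | add φ ψ _ _ hφ hψ =>
    obtain ⟨a, ha, hφa⟩ := hφ
    obtain ⟨b, hb, hψb⟩ := hψ
    exact ⟨a + b, A.add_mem ha hb, by rw [map_add, add_sub_add_comm]; exact add_mem hφa hψb⟩
  | smul ψ φ _ hφ =>
    obtain ⟨a, ha, hφa⟩ := hφ
    obtain ⟨r, hr⟩ := hx.exists_sub_aeval_mem_pow ψ k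
    refine ⟨r * a, A.mul_mem_left r ha, ?_⟩
    have : ψ • φ - aeval x (r * a) = ψ * (φ - aeval x a) + aeval x a * (ψ - aeval x r) := by
      rw [smul_eq_mul, map_mul]; ring
    rw [this]
    exact add_mem (Ideal.mul_mem_left _ _ hφa) (Ideal.mul_mem_left _ _ hr)

theorem IsCoordinates.mem_of_aeval_mem_map (hx : IsCoordinates K x)
    {A : Ideal (MvPolynomial σ K)} (hA : A.IsHomogeneous (homogeneousSubmodule σ K))
    {p : MvPolynomial σ K} {k : ℕ} (hp : p.IsHomogeneous k) (h : aeval x p ∈ A.map (aeval x)) :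
    p ∈ A := by
  obtain ⟨a, ha, hpa⟩ := hx.exists_sub_aeval_mem_pow_of_mem_map h (k + 1)
  rw [← map_sub, hx.aeval_mem_pow_iff] at hpa
  have hcomp := homogeneousComponent_eq_zero_of_mem_idealOfVars_pow hpa k.lt_succ_self
  rw [map_sub, homogeneousComponent_eq_self hp, sub_eq_zero] at hcomp
  rw [hcomp]
  exact homogeneousComponent_mem_of_mem hA ha k

variable {ι : Type*} {d : ℕ} {P : ι → MvPolynomial σ K} {F : ι → E}

local notation "J" => Ideal.span (Set.range F)

theorem aeval_mem_sup_of_mem_span (hP : ∀ i, (P i).IsHomogeneous d)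
    (hF : ∀ i, F i - aeval x (P i) ∈ 𝔪 ^ (d + 1)) {e : ℕ} {p : MvPolynomial σ K}
    (hp : p.IsHomogeneous e) (hpP : p ∈ Ideal.span (Set.range P)) :
    aeval x p ∈ J ⊔ 𝔪 ^ (e + 1) := by
  obtain ⟨r, rfl⟩ := Finsupp.mem_ideal_span_range_iff_exists_finsupp.1 hpP
  rw [← homogeneousComponent_eq_self hp, Finsupp.sum, map_sum, map_sum]
  refine Ideal.sum_mem _ fun i _ => ?_
  rw [mul_comm, homogeneousComponent_mul_of_isHomogeneous (hP i)]
  split_ifs with hde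
  · set s := homogeneousComponent (e - d) (r i)
    have hs : aeval x s ∈ 𝔪 ^ (e - d) := aeval_mem_pow
      (mem_idealOfVars_pow_of_isHomogeneous (homogeneousComponent_isHomogeneous _ _))
    have hsF := Ideal.mul_mem_mul hs (hF i)
    rw [← pow_add, show e - d + (d + 1) = e + 1 by lia] at hsF
    have : aeval x (P i * s) = aeval x s * F i - aeval x s * (F i - aeval x (P i)) := by
      rw [map_mul]; ring
    rw [this]
    exact sub_mem (Ideal.mem_sup_left (Ideal.mul_mem_left _ _ (Ideal.subset_span ⟨i, rfl⟩)))
      (Ideal.mem_sup_right hsF)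
  · simp

variable [Finite σ]

theorem IsCoordinates.pow_le_span (hx : IsCoordinates K x)
    (hP : ∀ i, (P i).IsHomogeneous d) (hF : ∀ i, F i - aeval x (P i) ∈ 𝔪 ^ (d + 1)) {k : ℕ}
    (hk : ∀ p : MvPolynomial σ K, p.IsHomogeneous k → p ∈ Ideal.span (Set.range P)) :
    𝔪 ^ k ≤ J := by
  have hfg : (𝔪 ^ k).FG := Submodule.FG.pow (Submodule.fg_span (Set.finite_range x)) k
  refine Submodule.le_of_le_smul_of_le_jacobson_bot hfg hx.le_jacobson fun φ hφ => ?_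
  obtain ⟨p, hp, hφp⟩ := hx.exists_isHomogeneous hφ
  rw [smul_eq_mul, ← pow_succ', ← sub_add_cancel φ (aeval x p)]
  exact add_mem (Ideal.mem_sup_right hφp) (aeval_mem_sup_of_mem_span hP hF hp (hk p hp))

theorem IsCoordinates.finite_finrank_quotient_sup_pow_le (hx : IsCoordinates K x)
    (hP : ∀ i, (P i).IsHomogeneous d) (hF : ∀ i, F i - aeval x (P i) ∈ 𝔪 ^ (d + 1)) (k : ℕ) :
    Module.Finite K (E ⧸ J ⊔ 𝔪 ^ k) ∧ Module.finrank K (E ⧸ J ⊔ 𝔪 ^ k) ≤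
      ∑ e ∈ Finset.range k, hilbertFun (Ideal.span (Set.range P)) e := by
  induction k with
  | zero =>
    have htop : J ⊔ 𝔪 ^ 0 = ⊤ := by simp
    have := Ideal.Quotient.subsingleton_iff.2 htop
    exact ⟨inferInstance, by rw [Module.finrank_zero_of_subsingleton]; exact Nat.zero_le _⟩
  | succ k ih =>
    obtain ⟨hfin, hrank⟩ := ih
    let f : (homogeneousSubmodule σ K k ⧸ gradedPart (Ideal.span (Set.range P)) k) →ₗ[K]
        E ⧸ J ⊔ 𝔪 ^ (k + 1) :=
      Submodule.liftQ _ ((Ideal.Quotient.mkₐ K (J ⊔ 𝔪 ^ (k + 1))).toLinearMap ∘ₗ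
        (aeval x).toLinearMap ∘ₗ Submodule.subtype _) fun p hp =>
          Ideal.Quotient.eq_zero_iff_mem.2 (aeval_mem_sup_of_mem_span hP hF p.2 hp)
    let g := (Ideal.Quotient.factorₐ K
      (sup_le_sup_left (Ideal.pow_le_pow_right k.le_succ) J :
        J ⊔ 𝔪 ^ (k + 1) ≤ J ⊔ 𝔪 ^ k)).toLinearMap
    have hgf : g.ker ≤ f.range := by
      intro y hy
      obtain ⟨φ, rfl⟩ := Ideal.Quotient.mk_surjective y
      obtain ⟨j, hj, s, hs, rfl⟩ := Submodule.mem_sup.1 (Ideal.Quotient.eq_zero_iff_mem.1 hy)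
      obtain ⟨p, hp, hsp⟩ := hx.exists_isHomogeneous hs
      refine ⟨Submodule.mkQ _ ⟨p, hp⟩, (Ideal.Quotient.eq.2 ?_).symm⟩
      change j + s - aeval x p ∈ _
      rw [add_sub_assoc]
      exact add_mem (Ideal.mem_sup_left hj) (Ideal.mem_sup_right hsp)
    refine ⟨finite_of_ker_le_range hgf, (finrank_le_of_ker_le_range hgf).trans ?_⟩
    rw [Finset.sum_range_succ, add_comm]
    exact Nat.add_le_add_right hrank _

end UpperBound

/-! ### Lower bound for the codimension -/

section LowerBound

open MvPolynomial TensorProduct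

variable {σ K E : Type*} [Field K] [CommRing E] [Algebra K E] {x F : σ → E}

local notation "𝔪" => Ideal.span (Set.range x)

local notation "J" => Ideal.span (Set.range F)

variable (K F) in
theorem exists_linearMap_tensorProduct (N : ℕ) :
    ∃ f : homogeneousSubmodule σ K N ⊗[K] (E ⧸ J) →ₗ[K] E ⧸ J ^ (N + 1),
      ∀ φ ∈ J ^ N, Ideal.Quotient.mk (J ^ (N + 1)) φ ∈ f.range := by
  obtain ⟨s, hs⟩ := (Ideal.Quotient.mkₐ K J).toLinearMap.exists_rightInverse_of_surjective
    (LinearMap.range_eq_top.2 Ideal.Quotient.mk_surjective)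
  have hs (φ : E) : φ - s (Ideal.Quotient.mk J φ) ∈ J :=
    Ideal.Quotient.eq.1 (LinearMap.congr_fun hs (Ideal.Quotient.mk J φ)).symm
  let f := (Ideal.Quotient.mkₐ K (J ^ (N + 1))).toLinearMap ∘ₗ TensorProduct.lift
    ((LinearMap.mul K E).compl₁₂
      ((aeval F).toLinearMap ∘ₗ (homogeneousSubmodule σ K N).subtype) s)
  refine ⟨f, fun φ hφ => ?_⟩
  obtain ⟨P, hP, rfl⟩ := (Ideal.mem_span_pow_iff_exists_isHomogeneous _ _).1 hφ
  rw [eval_eq, map_sum]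
  refine Submodule.sum_mem _ fun m hm => ?_
  have hdeg : m.degree = N := of_not_not fun h => mem_support_iff.1 hm (hP.coeff_eq_zero h)
  have hmon := isHomogeneous_monomial (1 : K) hdeg
  refine ⟨⟨monomial m 1, hmon⟩ ⊗ₜ Ideal.Quotient.mk J (P.coeff m), (Ideal.Quotient.eq.2 ?_).symm⟩
  have hmem := aeval_mem_pow (x := F) (mem_idealOfVars_pow_of_isHomogeneous hmon)
  have hprod := Ideal.mul_mem_mul (hs (P.coeff m)) hmem
  rw [← pow_succ', sub_mul] at hprod
  simpa [aeval_monomial, Finsupp.prod, mul_comm] using hprod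

variable [Finite σ]

variable (K F) in
theorem finite_finrank_quotient_pow_le [Module.Finite K (E ⧸ J)] (N : ℕ) :
    Module.Finite K (E ⧸ J ^ N) ∧ Module.finrank K (E ⧸ J ^ N) ≤
      (∑ e ∈ Finset.range N, Module.finrank K (homogeneousSubmodule σ K e)) *
        Module.finrank K (E ⧸ J) := by
  induction N with
  | zero =>
    have := Ideal.Quotient.subsingleton_iff.2 (show J ^ 0 = ⊤ by simp)
    exact ⟨inferInstance, by rw [Module.finrank_zero_of_subsingleton]; exact Nat.zero_le _⟩
  | succ N ih =>
    obtain ⟨hfin, hrank⟩ := ih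
    obtain ⟨f, hf⟩ := exists_linearMap_tensorProduct K F N
    let g := (Ideal.Quotient.factorₐ K (Ideal.pow_le_pow_right N.le_succ :
      J ^ (N + 1) ≤ J ^ N)).toLinearMap
    have hgf : g.ker ≤ f.range := by
      intro y hy
      obtain ⟨φ, rfl⟩ := Ideal.Quotient.mk_surjective y
      exact hf φ (Ideal.Quotient.eq_zero_iff_mem.1 hy)
    refine ⟨finite_of_ker_le_range (V₁ := homogeneousSubmodule σ K N ⊗[K] (E ⧸ J)) hgf,
      (finrank_le_of_ker_le_range (V₁ := homogeneousSubmodule σ K N ⊗[K] (E ⧸ J)) hgf).trans ?_⟩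
    rw [Module.finrank_tensorProduct, Finset.sum_range_succ, add_mul, add_comm]
    exact Nat.add_le_add_right hrank _

theorem IsCoordinates.sum_finrank_le (hx : IsCoordinates K x) {I : Ideal E} {N : ℕ}
    (hI : I ≤ 𝔪 ^ N) [Module.Finite K (E ⧸ I)] :
    ∑ e ∈ Finset.range N, Module.finrank K (homogeneousSubmodule σ K e) ≤
      Module.finrank K (E ⧸ I) := by
  let toPoly : (∀ e : Fin N, homogeneousSubmodule σ K e) →ₗ[K] MvPolynomial σ K :=
    ∑ e, Submodule.subtype _ ∘ₗ LinearMap.proj e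
  let f := (Ideal.Quotient.mkₐ K I).toLinearMap ∘ₗ (aeval x).toLinearMap ∘ₗ toPoly
  have hf : Function.Injective f := by
    refine LinearMap.ker_eq_bot.1 (LinearMap.ker_eq_bot'.2 fun v hv => funext fun e => ?_)
    have hmem := hx.aeval_mem_pow_iff.1 (hI (Ideal.Quotient.eq_zero_iff_mem.1 hv))
    have hcomp := homogeneousComponent_eq_zero_of_mem_idealOfVars_pow hmem e.2
    refine Subtype.ext (Eq.trans ?_ hcomp)
    simp [toPoly, homogeneousComponent_of_mem (v _).2, Fin.val_inj]
  simpa [Module.finrank_pi_fintype, Finset.sum_range] using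
    LinearMap.finrank_le_finrank_of_injective hf

theorem pow_le_of_forall_mul_pow_le {d D n : ℕ}
    (h : ∀ N ≠ 0, (d * N) ^ n ≤ D * (N + n) ^ n) : d ^ n ≤ D := by
  have hlim : Tendsto (fun N : ℕ => (D : ℝ) * (1 + (n : ℝ) / N) ^ n) atTop
      (𝓝 ((D : ℝ) * (1 + 0) ^ n)) :=
    ((tendsto_const_nhds.add (tendsto_const_div_atTop_nhds_zero_nat (n : ℝ))).pow n).const_mul _
  have hle : ∀ᶠ N : ℕ in atTop, (d : ℝ) ^ n ≤ D * (1 + (n : ℝ) / N) ^ n := by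
    filter_upwards [eventually_ne_atTop 0] with N hN
    have hN0 : (0 : ℝ) < N := by exact_mod_cast Nat.pos_of_ne_zero hN
    rw [one_add_div hN0.ne', div_pow, ← mul_div_assoc, le_div_iff₀ (by positivity), ← mul_pow]
    exact_mod_cast h N hN
  exact_mod_cast (by simpa using ge_of_tendsto hlim hle : (d : ℝ) ^ n ≤ D)

end LowerBound

section Codimension

open MvPolynomial

variable {σ K E : Type*} [Fintype σ] [Field K] [CommRing E] [Algebra K E] {x F : σ → E} {d : ℕ}

local notation "𝔪" => Ideal.span (Set.range x)

local notation "J" => Ideal.span (Set.range F)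

theorem IsCoordinates.pow_card_le_finrank_of_ne_zero (hx : IsCoordinates K x) (hd : d ≠ 0)
    (hF : ∀ i, F i ∈ 𝔪 ^ d) [Module.Finite K (E ⧸ J)] :
    d ^ Fintype.card σ ≤ Module.finrank K (E ⧸ J) := by
  refine pow_le_of_forall_mul_pow_le fun N hN => ?_
  obtain ⟨hfin, hrank⟩ := finite_finrank_quotient_pow_le K F N
  have hJ : J ^ N ≤ 𝔪 ^ (d * N) := by
    rw [pow_mul]
    exact Ideal.pow_right_mono (Ideal.span_le.2 (Set.range_subset_iff.2 hF)) N
  calc (d * N) ^ Fintype.card σ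
    _ ≤ (Fintype.card σ).factorial *
          ∑ e ∈ Finset.range (d * N), Module.finrank K (homogeneousSubmodule σ K e) :=
        pow_card_le_factorial_mul_sum_finrank (mul_ne_zero hd hN)
    _ ≤ (Fintype.card σ).factorial *
          ((∑ e ∈ Finset.range N, Module.finrank K (homogeneousSubmodule σ K e)) *
            Module.finrank K (E ⧸ J)) := by grw [hx.sum_finrank_le hJ, hrank]
    _ = Module.finrank K (E ⧸ J) * ((Fintype.card σ).factorial *
          ∑ e ∈ Finset.range N, Module.finrank K (homogeneousSubmodule σ K e)) := by ring
    _ ≤ Module.finrank K (E ⧸ J) * (N + Fintype.card σ) ^ Fintype.card σ := by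
        grw [factorial_mul_sum_finrank_le_pow_card hN]

theorem IsCoordinates.pow_card_le_finrank (hx : IsCoordinates K x) (hF : ∀ i, F i ∈ 𝔪 ^ d)
    [Module.Finite K (E ⧸ J)] : d ^ Fintype.card σ ≤ Module.finrank K (E ⧸ J) := by
  rcases eq_or_ne d 0 with rfl | hd
  · cases isEmpty_or_nonempty σ with
    | inl _ => simpa using hx.pow_card_le_finrank_of_ne_zero one_ne_zero (F := F) isEmptyElim
    | inr _ => simp
  · exact hx.pow_card_le_finrank_of_ne_zero hd hF

theorem IsCoordinates.finite_finrank_quotient_eq_pow [Infinite K] (hx : IsCoordinates K x)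
    {P : σ → MvPolynomial σ K} (hP : ∀ i, (P i).IsHomogeneous d)
    (hF : ∀ i, F i - aeval x (P i) ∈ 𝔪 ^ (d + 1))
    [Module.Finite K (E ⧸ Ideal.span (Set.range fun i => aeval x (P i)))] :
    Module.Finite K (E ⧸ J) ∧ Module.finrank K (E ⧸ J) = d ^ Fintype.card σ := by
  obtain ⟨k, hk⟩ : ∃ k, 𝔪 ^ k ≤ Ideal.span (Set.range fun i => aeval x (P i)) :=
    exists_pow_le_of_le_jacobson (K := K) hx.le_jacobson
  have hmap : Ideal.span (Set.range fun i => aeval x (P i)) =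
      (Ideal.span (Set.range P)).map (aeval x) := by rw [Ideal.map_span, ← Set.range_comp]; rfl
  have hforms (p : MvPolynomial σ K) (hp : p.IsHomogeneous k) : p ∈ Ideal.span (Set.range P) :=
    hx.mem_of_aeval_mem_map (isHomogeneous_span (Set.forall_mem_range.2 hP)) hp
      (hmap ▸ hk (aeval_mem_pow (mem_idealOfVars_pow_of_isHomogeneous hp)))
  obtain ⟨hfin, hrank⟩ := hx.finite_finrank_quotient_sup_pow_le hP hF k
  rw [sup_eq_left.2 (hx.pow_le_span hP hF hforms)] at hfin hrank
  have hFd (i : σ) : F i ∈ 𝔪 ^ d := by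
    rw [← sub_add_cancel (F i) (aeval x (P i))]
    exact add_mem (Ideal.pow_le_pow_right d.le_succ (hF i))
      (aeval_mem_pow (mem_idealOfVars_pow_of_isHomogeneous (hP i)))
  exact ⟨hfin, (hrank.trans (sum_hilbertFun_span_le hP hforms k)).antisymm
    (hx.pow_card_le_finrank hFd)⟩

end Codimension

/-! ### Leading forms -/

section LeadingForms

open MvPolynomial

variable {σ K E : Type*} [CommRing K] [CommRing E] [Algebra K E] {x : σ → E} {φ ψ : E}
  {P : MvPolynomial σ K} {m : ℕ}

local notation "𝔪" => Ideal.span (Set.range x)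

variable (x φ P m) in
/-- `P` is the leading form of `φ` with respect to the coordinates `x`, and its degree is `m`. -/
structure HasLeadingForm : Prop where
  isHomogeneous : P.IsHomogeneous m
  ne_zero : P ≠ 0
  sub_aeval_mem : φ - aeval x P ∈ 𝔪 ^ (m + 1)

theorem HasLeadingForm.le_of_mem_pow (h : HasLeadingForm x φ P m) (hx : IsCoordinates K x) {k : ℕ}
    (hφ : φ ∈ 𝔪 ^ k) : k ≤ m := by
  by_contra! hmk
  refine h.ne_zero (hx.eq_zero_of_aeval_mem m P h.isHomogeneous ?_)
  rw [← sub_sub_cancel φ (aeval x P)]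
  exact sub_mem (Ideal.pow_le_pow_right hmk hφ) h.sub_aeval_mem

theorem HasLeadingForm.of_sub_mem (h : HasLeadingForm x ψ P m) (hφ : φ - ψ ∈ 𝔪 ^ (m + 1)) :
    HasLeadingForm x φ P m where
  isHomogeneous := h.isHomogeneous
  ne_zero := h.ne_zero
  sub_aeval_mem := sub_add_sub_cancel φ ψ (aeval x P) ▸ add_mem hφ h.sub_aeval_mem

theorem IsCoordinates.exists_hasLeadingForm (hx : IsCoordinates K x) {k : ℕ} (hφ : φ ∉ 𝔪 ^ k) :
    ∃ m < k, ∃ P : MvPolynomial σ K, HasLeadingForm x φ P m := by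
  induction k with
  | zero => simp at hφ
  | succ k ih =>
    by_cases hφk : φ ∈ 𝔪 ^ k
    · obtain ⟨P, hP, hφP⟩ := hx.exists_isHomogeneous hφk
      refine ⟨k, k.lt_succ_self, P, hP, ?_, hφP⟩
      rintro rfl
      exact hφ (by simpa using hφP)
    · obtain ⟨m, hm, P, hP⟩ := ih hφk
      exact ⟨m, hm.trans k.lt_succ_self, P, hP⟩

end LeadingForms

/-! ### Hadamard's lemma -/

section ParametricIntegral

universe u

variable {H E : Type u} [NormedAddCommGroup H] [NormedSpace ℝ H] [FiniteDimensional ℝ H]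
  [NormedAddCommGroup E] [NormedSpace ℝ E] {f : H × ℝ → E} {a b : ℝ}

theorem hasFDerivAt_intervalIntegral (hf : ContDiff ℝ 1 f) (x₀ : H) :
    HasFDerivAt (fun x => ∫ t in a..b, f (x, t))
      (∫ t in a..b, fderiv ℝ f (x₀, t) ∘L ContinuousLinearMap.inl ℝ H ℝ) x₀ := by
  have : ProperSpace H := FiniteDimensional.proper_real H
  have hf' : Continuous fun p : H × ℝ => fderiv ℝ f p ∘L ContinuousLinearMap.inl ℝ H ℝ :=
    (hf.continuous_fderiv one_ne_zero).clm_comp continuous_const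
  obtain ⟨C, hC⟩ := ((isCompact_closedBall x₀ 1).prod
    (isCompact_uIcc (a := a) (b := b))).exists_bound_of_continuousOn hf'.continuousOn
  have hcont (x : H) : Continuous fun t : ℝ => f (x, t) := hf.continuous.comp (by fun_prop)
  refine intervalIntegral.hasFDerivAt_integral_of_dominated_of_fderiv_le
    (F' := fun x t => fderiv ℝ f (x, t) ∘L ContinuousLinearMap.inl ℝ H ℝ)
    (Metric.closedBall_mem_nhds x₀ one_pos)
    (.of_forall fun x => (hcont x).aestronglyMeasurable) ((hcont x₀).intervalIntegrable _ _)
    (hf'.comp (by fun_prop : Continuous fun t : ℝ => (x₀, t))).aestronglyMeasurable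
    (.of_forall fun t ht x hx => hC (x, t) ⟨hx, Set.uIoc_subset_uIcc ht⟩)
    intervalIntegrable_const (.of_forall fun t _ x _ => ?_)
  exact (hf.differentiable one_ne_zero (x, t)).hasFDerivAt.comp x
    ((hasFDerivAt_id x).prodMk (hasFDerivAt_const t x))

theorem contDiff_natCast_intervalIntegral (k : ℕ) (hf : ContDiff ℝ ∞ f) :
    ContDiff ℝ k fun x => ∫ t in a..b, f (x, t) := by
  induction k generalizing E with
  | zero =>
    exact contDiff_zero.2 <| intervalIntegral.continuous_parametric_intervalIntegral_of_continuous'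
      (f := fun x t => f (x, t)) hf.continuous a b
  | succ k ih =>
    push_cast
    exact contDiff_succ_iff_hasFDerivAt.2
      ⟨_, ih (f := fun p => fderiv ℝ f p ∘L ContinuousLinearMap.inl ℝ H ℝ)
        ((hf.fderiv_right (by simp)).clm_comp contDiff_const),
      hasFDerivAt_intervalIntegral (hf.of_le (by exact_mod_cast le_top))⟩

theorem contDiff_intervalIntegral (hf : ContDiff ℝ ∞ f) :
    ContDiff ℝ ∞ fun x => ∫ t in a..b, f (x, t) :=
  contDiff_infty.2 fun k => contDiff_natCast_intervalIntegral k hf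

end ParametricIntegral

section Hadamard

variable {n : ℕ}

theorem fderiv_apply_eq_sum (F : Eucl n → ℝ) (y x : Eucl n) :
    fderiv ℝ F y x = ∑ i, x i * partialFun i F y := by
  conv_lhs => rw [← (EuclideanSpace.basisFun (Fin n) ℝ).sum_repr x]
  simp [partialFun]

theorem contDiff_partialFun {F : Eucl n → ℝ} (hF : ContDiff ℝ ∞ F) (i : Fin n) :
    ContDiff ℝ ∞ (partialFun i F) :=
  (hF.fderiv_right (by simp)).clm_apply contDiff_const

theorem exists_eq_add_sum_mul {F : Eucl n → ℝ} (hF : ContDiff ℝ ∞ F) :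
    ∃ G : Fin n → Eucl n → ℝ, (∀ i, ContDiff ℝ ∞ (G i)) ∧ ∀ x, F x = F 0 + ∑ i, x i * G i x := by
  refine ⟨fun i x => ∫ t in (0 : ℝ)..1, partialFun i F (t • x), fun i => ?_, fun x => ?_⟩
  · exact contDiff_intervalIntegral (f := fun p : Eucl n × ℝ => partialFun i F (p.2 • p.1))
      ((contDiff_partialFun hF i).comp (contDiff_snd.smul contDiff_fst))
  · have hcont (i : Fin n) : Continuous fun t : ℝ => x i * partialFun i F (t • x) :=
      continuous_const.mul ((contDiff_partialFun hF i).continuous.comp (by fun_prop))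
    have htaylor := map_add_eq_sum_add_integral_iteratedFDeriv (f := F) (x := 0) (y := x) (n := 0)
      fun t _ => (hF.of_le (by simp)).contDiffAt
    simp_rw [← intervalIntegral.integral_const_mul]
    rw [← intervalIntegral.integral_finsetSum fun i _ => (hcont i).intervalIntegrable 0 1]
    simpa [fderiv_apply_eq_sum] using htaylor

end Hadamard

/-! ### Coordinates on the algebra of smooth germs -/

section Germs

open MvPolynomial

variable {n : ℕ}

/-- The germ at the origin of a smooth function. -/
def germOf (F : Eucl n → ℝ) (hF : ContDiff ℝ ∞ F) : SmoothGerm n :=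
  ⟨(F : Germ (𝓝 (0 : Eucl n)) ℝ), F, ⟨Set.univ, isOpen_univ, trivial, hF.contDiffOn⟩, rfl⟩

theorem exists_germOf_eq (φ : SmoothGerm n) : ∃ F, ∃ hF : ContDiff ℝ ∞ F, germOf F hF = φ := by
  obtain ⟨_, F, ⟨U, hU, h0, hF⟩, rfl⟩ := φ
  obtain ⟨r, hr, hrU⟩ := Metric.nhds_basis_closedBall.mem_iff.1 (hU.mem_nhds h0)
  let χ : ContDiffBump (0 : Eucl n) := ⟨r / 2, r, half_pos hr, half_lt_self hr⟩
  have hsmooth : ContDiff ℝ ∞ fun x => χ x * F x := by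
    refine contDiff_iff_contDiffAt.2 fun x => ?_
    by_cases hx : x ∈ U
    · exact χ.contDiff.contDiffAt.mul (hF.contDiffAt (hU.mem_nhds hx))
    · have hx' : x ∉ tsupport χ := fun h => hx (hrU (by rwa [χ.tsupport_eq] at h))
      refine (contDiffAt_const (c := (0 : ℝ))).congr_of_eventuallyEq ?_
      filter_upwards [notMem_tsupport_iff_eventuallyEq.1 hx'] with y hy
      simp [hy]
  refine ⟨_, hsmooth, Subtype.ext (Germ.coe_eq.2 ?_)⟩
  filter_upwards [χ.eventuallyEq_one] with x hx
  simp [hx]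

/-- The germ of the `i`-th coordinate function. -/
def coord (i : Fin n) : SmoothGerm n := germOf (fun x => x i) (by fun_prop)

local notation "𝔪" => Ideal.span (Set.range (coord (n := n)))

theorem coe_algebraMap (c : ℝ) :
    (algebraMap ℝ (SmoothGerm n) c).1 = ((fun _ => c : Eucl n → ℝ) : Germ (𝓝 (0 : Eucl n)) ℝ) := by
  rw [Algebra.algebraMap_eq_smul_one]
  exact congrArg Germ.ofFun (funext fun _ => mul_one c)

theorem coe_aeval_coord (p : MvPolynomial (Fin n) ℝ) :
    (aeval coord p : SmoothGerm n).1 =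
      ((fun x : Eucl n => eval x p : Eucl n → ℝ) : Germ (𝓝 (0 : Eucl n)) ℝ) := by
  have heq : (SmoothGerm n).val.toRingHom.comp (aeval coord).toRingHom =
      (Germ.coeRingHom (𝓝 (0 : Eucl n))).comp (RingHom.pi fun x : Eucl n => eval x) := by
    refine ringHom_ext (fun c => ?_) fun i => ?_
    · refine (congrArg (SmoothGerm n).val (aeval_C coord c)).trans ((coe_algebraMap c).trans ?_)
      exact Germ.coe_eq.2 (.of_forall fun x => (eval_C c).symm)
    · refine (congrArg (SmoothGerm n).val (aeval_X coord i)).trans ?_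
      exact Germ.coe_eq.2 (.of_forall fun x => (eval_X i).symm)
  exact RingHom.congr_fun heq p

/-- The value of a germ at the origin. -/
def valueHom (n : ℕ) : SmoothGerm n →+* ℝ :=
  (Germ.valueRingHom (x := (0 : Eucl n))).comp (SmoothGerm n).val.toRingHom

theorem valueHom_algebraMap (c : ℝ) : valueHom n (algebraMap ℝ (SmoothGerm n) c) = c :=
  congrArg Germ.value (coe_algebraMap (n := n) c)

theorem germOf_eq_add_sum {F : Eucl n → ℝ} (hF : ContDiff ℝ ∞ F) {G : Fin n → Eucl n → ℝ}
    (hG : ∀ i, ContDiff ℝ ∞ (G i)) {c : ℝ} (hFG : ∀ x, F x = c + ∑ i, x i * G i x) :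
    germOf F hF = algebraMap ℝ (SmoothGerm n) c + ∑ i, coord i * germOf (G i) (hG i) := by
  refine Subtype.ext ?_
  rw [AddMemClass.coe_add, AddSubmonoidClass.coe_finsetSum, coe_algebraMap]
  have hmul (i : Fin n) : (coord i * germOf (G i) (hG i) : SmoothGerm n).1 =
    Germ.coeRingHom (𝓝 (0 : Eucl n)) fun x => x i * G i x := rfl
  simp_rw [hmul]
  rw [← map_sum]
  exact congrArg Germ.ofFun (funext fun x => by simp [hFG x])

theorem span_coord_eq_ker_valueHom : 𝔪 = RingHom.ker (valueHom n) := by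
  refine le_antisymm (Ideal.span_le.2 ?_) fun φ hφ => ?_
  · rintro _ ⟨i, rfl⟩
    exact (rfl : (0 : Eucl n) i = 0)
  · obtain ⟨F, hF, rfl⟩ := exists_germOf_eq φ
    obtain ⟨G, hG, hFG⟩ := exists_eq_add_sum_mul hF
    rw [germOf_eq_add_sum hF hG hFG, show F 0 = 0 from hφ, map_zero, zero_add]
    exact Ideal.sum_mem _ fun i _ => Ideal.mul_mem_right _ _ (Ideal.subset_span ⟨i, rfl⟩)

theorem isUnit_of_valueHom_ne_zero {φ : SmoothGerm n} (hφ : valueHom n φ ≠ 0) : IsUnit φ := by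
  obtain ⟨F, hF, rfl⟩ := exists_germOf_eq φ
  have hU : IsOpen {x | F x ≠ 0} := isOpen_ne_fun hF.continuous continuous_const
  let ψ : SmoothGerm n := ⟨((fun x => (F x)⁻¹ : Eucl n → ℝ) : Germ (𝓝 (0 : Eucl n)) ℝ), _,
    ⟨_, hU, hφ, fun x hx => (hF.contDiffAt.inv hx).contDiffWithinAt⟩, rfl⟩
  refine IsUnit.of_mul_eq_one ψ (Subtype.ext (Germ.coe_eq.2 ?_))
  filter_upwards [hU.mem_nhds hφ] with x hx
  exact mul_inv_cancel₀ hx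

theorem span_coord_le_jacobson : 𝔪 ≤ Ideal.jacobson ⊥ := by
  intro φ hφ
  refine Ideal.mem_jacobson_bot.2 fun ψ => isUnit_of_valueHom_ne_zero ?_
  rw [span_coord_eq_ker_valueHom, RingHom.mem_ker] at hφ
  rw [map_add, map_mul, hφ, zero_mul, zero_add, map_one]
  exact one_ne_zero

end Germs

/-! ### Limits along rays -/

section RayLimits

open MvPolynomial

variable {n m : ℕ} {F G : Eucl n → ℝ} {α β L M : ℝ} {v : Eucl n}

local notation "𝔪" => Ideal.span (Set.range (coord (n := n)))

/-- `F(tv) / t^α → L` as `t → 0⁺`, as in the definition of the order; unlike there, `v = 0` is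
allowed. -/
def HasRayLimit (F : Eucl n → ℝ) (α : ℝ) (v : Eucl n) (L : ℝ) : Prop :=
  Tendsto (fun t : ℝ => F (t • v) / t ^ α) (𝓝[>] 0) (𝓝 L)

theorem tendsto_smul_nhdsGT_zero (v : Eucl n) :
    Tendsto (fun t : ℝ => t • v) (𝓝[>] 0) (𝓝 0) := by
  have h : Tendsto (fun t : ℝ => t • v) (𝓝 0) (𝓝 ((0 : ℝ) • v)) :=
    (continuous_id.smul continuous_const).tendsto 0
  exact (zero_smul ℝ v ▸ h).mono_left nhdsWithin_le_nhds

namespace HasRayLimit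

theorem unique (h : HasRayLimit F α v L) (h' : HasRayLimit F α v M) : L = M :=
  tendsto_nhds_unique h h'

theorem congr (h : HasRayLimit F α v L) (hFG : F =ᶠ[𝓝 0] G) : HasRayLimit G α v L := by
  refine Tendsto.congr' ?_ h
  filter_upwards [(tendsto_smul_nhdsGT_zero v).eventually hFG] with t ht
  rw [ht]

theorem add (h : HasRayLimit F α v L) (h' : HasRayLimit G α v M) :
    HasRayLimit (F + G) α v (L + M) := by
  simpa only [HasRayLimit, Pi.add_apply, add_div] using Tendsto.add h h'

theorem mul (h : HasRayLimit F α v L) (h' : HasRayLimit G β v M) :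
    HasRayLimit (F * G) (α + β) v (L * M) := by
  refine Tendsto.congr' ?_ (Tendsto.mul h h')
  filter_upwards [self_mem_nhdsWithin] with t ht
  rw [Real.rpow_add ht, Pi.mul_apply, mul_div_mul_comm]

/-- For `α = β` the factor is `0 ^ 0 = 1`, and it vanishes otherwise. -/
theorem of_le (h : HasRayLimit F β v L) (hαβ : α ≤ β) :
    HasRayLimit F α v (L * 0 ^ (β - α)) := by
  have hpow : Tendsto (fun t : ℝ => t ^ (β - α)) (𝓝[>] 0) (𝓝 (0 ^ (β - α))) :=
    (Real.continuous_rpow_const (sub_nonneg.2 hαβ)).continuousWithinAt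
  refine Tendsto.congr' ?_ (Tendsto.mul h hpow)
  filter_upwards [self_mem_nhdsWithin] with t ht
  rw [Real.rpow_sub ht, div_mul_div_cancel₀ (Real.rpow_pos_of_pos ht β).ne']

theorem of_forall_smul (hF : ∀ t : ℝ, 0 < t → F (t • v) = t ^ α * F v) :
    HasRayLimit F α v (F v) := by
  refine tendsto_const_nhds.congr' ?_
  filter_upwards [self_mem_nhdsWithin] with t ht
  rw [hF t ht, mul_div_cancel_left₀ _ (Real.rpow_pos_of_pos ht α).ne']

theorem of_hasFDerivAt {F' : Eucl n →L[ℝ] ℝ} (hF : HasFDerivAt F F' 0) (h0 : F 0 = 0)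
    (v : Eucl n) : HasRayLimit F 1 v (F' v) := by
  refine (hF.hasLineDerivAt v).tendsto_slope_zero_right.congr fun t => ?_
  rw [Real.rpow_one, zero_add, h0, sub_zero, smul_eq_mul, inv_mul_eq_div]

theorem of_tendsto_norm (h : Tendsto (fun x => F x / ‖x‖ ^ α) (𝓝[≠] 0) (𝓝 0)) (hv : v ≠ 0) :
    HasRayLimit F α v 0 := by
  have hray : Tendsto (fun t : ℝ => t • v) (𝓝[>] 0) (𝓝[≠] 0) := by
    refine tendsto_nhdsWithin_iff.2 ⟨tendsto_smul_nhdsGT_zero v, ?_⟩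
    filter_upwards [self_mem_nhdsWithin] with t ht
    exact smul_ne_zero (ne_of_gt ht) hv
  refine Tendsto.congr' ?_ (zero_mul (‖v‖ ^ α) ▸ (h.comp hray).mul_const (‖v‖ ^ α))
  filter_upwards [self_mem_nhdsWithin] with t ht
  have hvα := (Real.rpow_pos_of_pos (norm_pos_iff.2 hv) α).ne'
  rw [Function.comp_apply, norm_smul, Real.norm_of_nonneg ht.le,
    Real.mul_rpow ht.le (norm_nonneg v), div_mul_eq_div_div, div_mul_cancel₀ _ hvα]

end HasRayLimit

theorem tendsto_value {φ : SmoothGerm n} (hF : (F : Germ (𝓝 (0 : Eucl n)) ℝ) = φ.1) :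
    Tendsto F (𝓝 0) (𝓝 φ.1.value) := by
  obtain ⟨F', hF', rfl⟩ := exists_germOf_eq φ
  exact (hF'.continuous.tendsto 0).congr' (Germ.coe_eq.1 hF.symm)

theorem eval_smul_of_isHomogeneous {P : MvPolynomial (Fin n) ℝ} (hP : P.IsHomogeneous m) (t : ℝ)
    (v : Eucl n) : eval (t • v : Eucl n) P = t ^ m * eval v P := by
  rw [eval_eq, eval_eq, Finset.mul_sum]
  refine Finset.sum_congr rfl fun s hs => ?_
  have hdeg : s.degree = m := of_not_not fun h => mem_support_iff.1 hs (hP.coeff_eq_zero h)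
  simp only [PiLp.smul_apply, smul_eq_mul, mul_pow, Finset.prod_mul_distrib,
    Finset.prod_pow_eq_pow_sum, ← Finsupp.degree_apply, hdeg]
  ring

theorem hasRayLimit_eval {P : MvPolynomial (Fin n) ℝ} (hP : P.IsHomogeneous m) (v : Eucl n) :
    HasRayLimit (fun x => eval x P) m v (eval v P) :=
  .of_forall_smul (F := fun x : Eucl n => eval x P) fun t _ => by
    rw [eval_smul_of_isHomogeneous hP, Real.rpow_natCast]

theorem exists_hasRayLimit_of_mem_pow {k : ℕ} {φ : SmoothGerm n}
    (hφ : φ ∈ 𝔪 ^ k) (hF : (F : Germ (𝓝 (0 : Eucl n)) ℝ) = φ.1)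
    (v : Eucl n) : ∃ L, HasRayLimit F k v L := by
  induction k generalizing φ F with
  | zero =>
    refine ⟨_, ((tendsto_value hF).comp (tendsto_smul_nhdsGT_zero v)).congr fun t => ?_⟩
    rw [Function.comp_apply, Nat.cast_zero, Real.rpow_zero, div_one]
  | succ k ih =>
    rw [pow_succ] at hφ
    induction hφ using Submodule.mul_induction_on' generalizing F with
    | mem_mul_mem φ hφ ψ hψ =>
      obtain ⟨A, hA, rfl⟩ := exists_germOf_eq φ
      obtain ⟨B, hB, rfl⟩ := exists_germOf_eq ψ
      rw [span_coord_eq_ker_valueHom] at hψ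
      obtain ⟨L, hL⟩ := ih hφ rfl
      have hM := HasRayLimit.of_hasFDerivAt (hB.differentiable (by simp) 0).hasFDerivAt hψ v
      exact ⟨_, by simpa using (hL.mul hM).congr (Germ.coe_eq.1 hF.symm)⟩
    | add φ _ ψ _ hφ hψ =>
      obtain ⟨A, hA, rfl⟩ := exists_germOf_eq φ
      obtain ⟨B, hB, rfl⟩ := exists_germOf_eq ψ
      obtain ⟨L, hL⟩ := hφ rfl
      obtain ⟨M, hM⟩ := hψ rfl
      exact ⟨_, (hL.add hM).congr (Germ.coe_eq.1 hF.symm)⟩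

theorem hasRayLimit_zero_of_mem_pow_succ {k : ℕ} {φ : SmoothGerm n}
    (hφ : φ ∈ 𝔪 ^ (k + 1))
    (hF : (F : Germ (𝓝 (0 : Eucl n)) ℝ) = φ.1) (hα : α ≤ k) (v : Eucl n) :
    HasRayLimit F α v 0 := by
  obtain ⟨L, hL⟩ := exists_hasRayLimit_of_mem_pow hφ hF v
  have hlt : α < (k + 1 : ℕ) := hα.trans_lt (by simp)
  simpa only [Real.zero_rpow (sub_pos.2 hlt).ne', mul_zero] using hL.of_le hlt.le

theorem isCoordinates_coord : IsCoordinates ℝ (coord (n := n)) where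
  exists_sub_algebraMap_mem φ := ⟨valueHom n φ, by
    rw [span_coord_eq_ker_valueHom, RingHom.mem_ker, map_sub, valueHom_algebraMap, sub_self]⟩
  eq_zero_of_aeval_mem k p hp h := MvPolynomial.funext fun v => by
    rw [map_zero]
    exact (hasRayLimit_eval hp (WithLp.toLp 2 v)).unique
      (hasRayLimit_zero_of_mem_pow_succ h (coe_aeval_coord p).symm le_rfl _)
  le_jacobson := span_coord_le_jacobson

end RayLimits

/-! ### Orders and leading forms -/

section Order

open MvPolynomial

variable {n m : ℕ} {F G : Eucl n → ℝ} {α β : ℝ≥0} {φ f g : SmoothGerm n}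
  {P : MvPolynomial (Fin n) ℝ}

local notation "𝔪" => Ideal.span (Set.range (coord (n := n)))

theorem HasOrder.congr (h : HasOrder F α) (hFG : F =ᶠ[𝓝 0] G) : HasOrder G α :=
  ⟨fun v hv => (h.1 v hv).imp fun _ hL => HasRayLimit.congr hL hFG,
    h.2.imp fun _ => .imp_right <| .imp fun _ => .imp_right fun hL => HasRayLimit.congr hL hFG⟩

theorem HasOrder.le (h : HasOrder F α) (h' : HasOrder F β) : β ≤ α := by
  obtain ⟨v, hv, L, hL, hFL⟩ := h.2
  obtain ⟨M, hM⟩ := h'.1 v hv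
  by_contra! hlt
  have hlt : (α : ℝ) < β := hlt
  refine hL (HasRayLimit.unique hFL ?_)
  simpa only [Real.zero_rpow (sub_pos.2 hlt).ne', mul_zero] using HasRayLimit.of_le hM hlt.le

theorem ord_eq_of_hasOrder (hφ : φ.1.value = 0) (hF : (F : Germ (𝓝 (0 : Eucl n)) ℝ) = φ.1)
    (h : HasOrder F α) : ord φ = α := by
  rw [ord, if_neg (not_not.2 hφ)]
  refine le_antisymm (iInf₂_le α ⟨F, hF, h⟩) (le_iInf₂ fun β ⟨G, hG, hβ⟩ => ?_)
  exact ENNReal.coe_le_coe.2 ((hβ.congr (Germ.coe_eq.1 (hG.trans hF.symm))).le h)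

theorem HasLeadingForm.hasRayLimit (h : HasLeadingForm coord φ P m)
    (hF : (F : Germ (𝓝 (0 : Eucl n)) ℝ) = φ.1) (v : Eucl n) : HasRayLimit F m v (eval v P) := by
  have hrest : HasRayLimit (F - fun x : Eucl n => eval x P) m v 0 := by
    refine hasRayLimit_zero_of_mem_pow_succ h.sub_aeval_mem ?_ le_rfl v
    rw [AddSubgroupClass.coe_sub, coe_aeval_coord, ← hF]
    rfl
  simpa using hrest.add (hasRayLimit_eval h.isHomogeneous v)

theorem HasLeadingForm.ne_zero_of_value_eq_zero (h : HasLeadingForm coord φ P m)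
    (hφ : φ.1.value = 0) : m ≠ 0 := by
  refine Nat.one_le_iff_ne_zero.1 (h.le_of_mem_pow isCoordinates_coord ?_)
  rw [pow_one, span_coord_eq_ker_valueHom]
  exact hφ

theorem HasLeadingForm.exists_eval_ne_zero (h : HasLeadingForm coord φ P m) (hm : m ≠ 0) :
    ∃ v : Eucl n, v ≠ 0 ∧ eval v P ≠ 0 := by
  obtain ⟨v, hv⟩ : ∃ v : Eucl n, eval v P ≠ 0 := by
    by_contra! hzero
    exact h.ne_zero (MvPolynomial.funext fun v => by simpa using hzero (WithLp.toLp 2 v))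
  refine ⟨v, ?_, hv⟩
  rintro rfl
  have hsmul := eval_smul_of_isHomogeneous h.isHomogeneous 0 (0 : Eucl n)
  rw [zero_smul, zero_pow hm, zero_mul] at hsmul
  exact hv hsmul

theorem HasLeadingForm.hasOrder (h : HasLeadingForm coord φ P m) (hm : m ≠ 0)
    (hF : (F : Germ (𝓝 (0 : Eucl n)) ℝ) = φ.1) : HasOrder F m := by
  obtain ⟨v, hv, hPv⟩ := h.exists_eval_ne_zero hm
  exact ⟨fun w _ => ⟨_, h.hasRayLimit hF w⟩, v, hv, _, hPv, h.hasRayLimit hF v⟩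

theorem HasLeadingForm.ord_eq (h : HasLeadingForm coord φ P m) (hφ : φ.1.value = 0) :
    ord φ = m := by
  obtain ⟨F, -, hF⟩ := φ.2
  exact ord_eq_of_hasOrder hφ hF (h.hasOrder (h.ne_zero_of_value_eq_zero hφ) hF)

theorem HasOrder.exists_hasLeadingForm (h : HasOrder F α)
    (hF : (F : Germ (𝓝 (0 : Eucl n)) ℝ) = φ.1) :
    ∃ (m : ℕ) (P : MvPolynomial (Fin n) ℝ), HasLeadingForm coord φ P m := by
  obtain ⟨k, hk⟩ := exists_nat_ge (α : ℝ)
  obtain ⟨v, -, L, hL, hFL⟩ := h.2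
  obtain ⟨m, -, P, hP⟩ := isCoordinates_coord.exists_hasLeadingForm (φ := φ) (k := k + 1)
    fun hφ => hL (HasRayLimit.unique hFL (hasRayLimit_zero_of_mem_pow_succ hφ hF hk v))
  exact ⟨m, P, hP⟩

theorem mem_pow_of_tendsto_norm (hφ : φ.1.value = 0) (hF : (F : Germ (𝓝 (0 : Eucl n)) ℝ) = φ.1)
    (h : Tendsto (fun x => F x / ‖x‖ ^ (m : ℝ)) (𝓝[≠] 0) (𝓝 0)) :
    φ ∈ 𝔪 ^ (m + 1) := by
  by_contra hmem
  obtain ⟨j, hj, Q, hQ⟩ := isCoordinates_coord.exists_hasLeadingForm hmem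
  obtain ⟨v, hv, hQv⟩ := hQ.exists_eval_ne_zero (hQ.ne_zero_of_value_eq_zero hφ)
  have hjm : (j : ℝ) ≤ m := by exact_mod_cast Nat.lt_succ_iff.1 hj
  refine hQv ((hQ.hasRayLimit hF v).unique ?_)
  simpa using (HasRayLimit.of_tendsto_norm h hv).of_le hjm

theorem apply_zero_of_posHomogeneous
    (hhom : ∀ (t : ℝ) (x : Eucl n), 0 < t → G (t • x) = t ^ (α : ℝ) * G x) (hα : α ≠ 0) :
    G 0 = 0 := by
  have hpos : (0 : ℝ) < α := NNReal.coe_pos.2 (pos_iff_ne_zero.2 hα)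
  have hG2 := hhom 2 0 two_pos
  rw [smul_zero] at hG2
  by_contra hG0
  exact (Real.one_lt_rpow one_lt_two hpos).ne' ((mul_eq_right₀ hG0).1 hG2.symm)

theorem exists_hasLeadingForm_of_posHomogeneous (hG : (G : Germ (𝓝 (0 : Eucl n)) ℝ) = φ.1)
    (hhom : ∀ (t : ℝ) (x : Eucl n), 0 < t → G (t • x) = t ^ (α : ℝ) * G x) (hα : α ≠ 0)
    (hne : ∃ v, G v ≠ 0) :
    ∃ (m : ℕ) (P : MvPolynomial (Fin n) ℝ), α = m ∧ HasLeadingForm coord φ P m ∧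
      ∀ v : Eucl n, G v = eval v P := by
  have hlim (v : Eucl n) : HasRayLimit G α v (G v) := .of_forall_smul fun t ht => hhom t v ht
  have hG0 := apply_zero_of_posHomogeneous hhom hα
  have hord : HasOrder G α := by
    obtain ⟨v, hv⟩ := hne
    exact ⟨fun w _ => ⟨_, hlim w⟩, v, fun h => hv (h ▸ hG0), _, hv, hlim v⟩
  obtain ⟨m, P, hP⟩ := hord.exists_hasLeadingForm hG
  have hm : m ≠ 0 := hP.ne_zero_of_value_eq_zero (by rw [← hG]; exact hG0)
  have hord' := hP.hasOrder hm hG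
  obtain rfl : α = m := (hord'.le hord).antisymm (hord.le hord')
  exact ⟨m, P, rfl, hP, fun v => (hlim v).unique (hP.hasRayLimit hG v)⟩

theorem IsInitialPart.exists_hasLeadingForm (hg : IsInitialPart f g) (hf : f.1.value = 0) :
    ∃ (m : ℕ) (P : MvPolynomial (Fin n) ℝ), g = aeval coord P ∧ HasLeadingForm coord f P m := by
  obtain ⟨α, F, G, hF, hG, hhom, hG_not, hFG⟩ := hg
  have hα : α ≠ 0 := by
    rintro rfl
    have hF0 : Tendsto F (𝓝[≠] 0) (𝓝 0) := (hf ▸ tendsto_value hF).mono_left nhdsWithin_le_nhds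
    exact hG_not (by simpa using hF0.sub hFG)
  have hne : ∃ v, G v ≠ 0 := by
    by_contra! hzero
    exact hG_not (by simpa only [hzero, zero_div] using tendsto_const_nhds)
  have hG0 := apply_zero_of_posHomogeneous hhom hα
  obtain ⟨m, P, rfl, hP, hGP⟩ := exists_hasLeadingForm_of_posHomogeneous hG hhom hα hne
  have hgP : g = aeval coord P := Subtype.ext <| by rw [coe_aeval_coord, ← hG, funext hGP]
  have hFGfg : ((F - G : Eucl n → ℝ) : Germ (𝓝 (0 : Eucl n)) ℝ) = (f - g).1 := by
    rw [AddSubgroupClass.coe_sub, ← hF, ← hG]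
    rfl
  refine ⟨m, P, hgP, hP.of_sub_mem (mem_pow_of_tendsto_norm ?_ hFGfg hFG)⟩
  rw [← hF] at hf
  rw [← hFGfg]
  exact (congrArg₂ (· - ·) hf hG0).trans (sub_zero 0)

end Order

/-! ### The Milnor number -/

section MilnorNumber

open MvPolynomial

theorem derivation_mem_pow {R E : Type*} [CommSemiring R] [CommRing E] [Algebra R E]
    (D : Derivation R E E) {I : Ideal E} {k : ℕ} {φ : E} (hφ : φ ∈ I ^ (k + 1)) : D φ ∈ I ^ k := by
  induction k generalizing φ with
  | zero => simp
  | succ k ih =>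
    rw [pow_succ] at hφ
    refine Submodule.mul_induction_on hφ (fun a ha b hb => ?_) fun a b ha hb => ?_
    · rw [Derivation.leibniz, smul_eq_mul, smul_eq_mul, pow_succ']
      exact add_mem (pow_succ' I k ▸ Ideal.mul_mem_right _ _ ha) (Ideal.mul_mem_mul hb (ih ha))
    · rw [map_add]
      exact add_mem ha hb

variable {n : ℕ}

local notation "𝔪" => Ideal.span (Set.range (coord (n := n)))

/-- `∂/∂xᵢ` as a derivation of the algebra of smooth germs. -/
def partialDerivation (i : Fin n) : Derivation ℝ (SmoothGerm n) (SmoothGerm n) :=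
  Derivation.mk'
    { toFun := partialDeriv i
      map_add' := fun φ ψ => by
        obtain ⟨F, hF, rfl⟩ := exists_germOf_eq φ
        obtain ⟨G, hG, rfl⟩ := exists_germOf_eq ψ
        refine Subtype.ext (Germ.coe_eq.2 (.of_forall fun x => ?_))
        exact DFunLike.congr_fun (fderiv_add (hF.differentiable (by simp) x)
          (hG.differentiable (by simp) x)) _
      map_smul' := fun c φ => by
        obtain ⟨F, hF, rfl⟩ := exists_germOf_eq φ
        refine Subtype.ext (Germ.coe_eq.2 (.of_forall fun x => ?_))
        exact DFunLike.congr_fun (fderiv_const_smul (hF.differentiable (by simp) x) c) _ }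
    fun φ ψ => by
      obtain ⟨F, hF, rfl⟩ := exists_germOf_eq φ
      obtain ⟨G, hG, rfl⟩ := exists_germOf_eq ψ
      refine Subtype.ext (Germ.coe_eq.2 (.of_forall fun x => ?_))
      exact DFunLike.congr_fun (fderiv_mul (hF.differentiable (by simp) x)
        (hG.differentiable (by simp) x)) _

theorem partialDerivation_coord (i j : Fin n) :
    partialDerivation i (coord j) = (Pi.single i 1 : Fin n → SmoothGerm n) j := by
  have h : partialDerivation i (coord j) =
      algebraMap ℝ (SmoothGerm n) ((Pi.single i 1 : Fin n → ℝ) j) := by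
    refine Subtype.ext ((Germ.coe_eq.2 (.of_forall fun x => ?_)).trans (coe_algebraMap _).symm)
    change fderiv ℝ (EuclideanSpace.proj j : Eucl n →L[ℝ] ℝ) x (EuclideanSpace.single i 1) = _
    rw [ContinuousLinearMap.fderiv]
    rfl
  rw [h, Pi.single_apply, Pi.single_apply, apply_ite (algebraMap ℝ (SmoothGerm n)), map_one,
    map_zero]

theorem partialDeriv_aeval_coord (i : Fin n) (p : MvPolynomial (Fin n) ℝ) :
    partialDeriv i (aeval coord p) = aeval coord (pderiv i p) := by
  change partialDerivation i (aeval coord p) = _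
  induction p using MvPolynomial.induction_on with
  | C a => rw [aeval_C, Derivation.map_algebraMap, pderiv_C, map_zero]
  | add p q hp hq => rw [map_add, map_add, map_add, map_add, hp, hq]
  | mul_X p j hp =>
    have hX : aeval coord ((Pi.single i 1 : Fin n → MvPolynomial (Fin n) ℝ) j) =
        (Pi.single i 1 : Fin n → SmoothGerm n) j := by
      rw [Pi.single_apply, Pi.single_apply, apply_ite (aeval coord), map_one, map_zero]
    rw [map_mul, Derivation.leibniz, Derivation.leibniz, hp, aeval_X, partialDerivation_coord,
      pderiv_X, map_add, smul_eq_mul, smul_eq_mul, smul_eq_mul, smul_eq_mul, map_mul, map_mul,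
      aeval_X, hX]

theorem AlgebraicallyIsolated.finite {φ : SmoothGerm n} (h : AlgebraicallyIsolated φ) :
    Module.Finite ℝ (SmoothGerm n ⧸ jacobianIdeal φ)  := by
  have := Module.Free.of_divisionRing ℝ (SmoothGerm n ⧸ jacobianIdeal φ)
  exact Module.rank_lt_aleph0_iff.1 (Cardinal.toENat_lt_top.1 h)

theorem HasLeadingForm.partialDeriv_sub_mem {f : SmoothGerm n} {P : MvPolynomial (Fin n) ℝ} {m : ℕ}
    (h : HasLeadingForm coord f P m) (hm : m ≠ 0) (i : Fin n) :
    partialDeriv i f - aeval coord (pderiv i P) ∈ 𝔪 ^ (m - 1 + 1) := by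
  rw [Nat.sub_one_add_one hm, ← partialDeriv_aeval_coord]
  have := derivation_mem_pow (partialDerivation i) h.sub_aeval_mem
  rwa [map_sub] at this

theorem HasLeadingForm.milnorNumber_eq {f : SmoothGerm n} {P : MvPolynomial (Fin n) ℝ} {m : ℕ}
    (h : HasLeadingForm coord f P m) (hm : m ≠ 0)
    (hP : AlgebraicallyIsolated (aeval coord P : SmoothGerm n)) :
    milnorNumber f = ((m - 1) ^ n : ℕ) := by
  have hJ : jacobianIdeal (aeval coord P) =
      Ideal.span (Set.range fun i => aeval coord (pderiv i P)) :=
    congrArg (Ideal.span <| Set.range ·) (funext fun i => partialDeriv_aeval_coord i P)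
  have hfin := hP.finite
  rw [hJ] at hfin
  obtain ⟨hfinf, hrank⟩ := isCoordinates_coord.finite_finrank_quotient_eq_pow
    (fun i => h.isHomogeneous.pderiv (i := i)) (h.partialDeriv_sub_mem hm)
  rw [milnorNumber, jacobianIdeal, ← Module.finrank_eq_rank, hrank, Cardinal.toENat_nat,
    Fintype.card_fin]

end MilnorNumber

end RealMilnor

end

theorem proposition4p2 (n : ℕ) (f g : RealMilnor.SmoothGerm n) (hf : f.1.value = 0)
    (hg : RealMilnor.IsInitialPart f g) (hiso : RealMilnor.AlgebraicallyIsolated g) :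
    ∃ m : ℕ, 1 ≤ m ∧ RealMilnor.ord f = (m : ENNReal) ∧
      RealMilnor.milnorNumber f = (((m - 1) ^ n : ℕ) : ℕ∞) := by
  obtain ⟨m, P, rfl, hP⟩ := hg.exists_hasLeadingForm hf
  have hm : m ≠ 0 := hP.ne_zero_of_value_eq_zero hf
  exact ⟨m, Nat.one_le_iff_ne_zero.2 hm, hP.ord_eq hf, hP.milnorNumber_eq hm hiso⟩
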